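/- Setting. For $n,d_1,d_2\ge 1$ put $T=d_1+d_2-1$, $d=\min(d_1,d_2)$, $I=[n]\times[n]\times[T]$. Let $\mathcal M$ be the space of direct sums $\widetilde X=X_1\oplus\dots\oplus X_T$ of real $n\times n$ matrices with the Frobenius inner product and standard basis $(E_{i,j,t})_{(i,j,t)\in I}$, let $\mathcal Q_T(A)=A\oplus A^2\oplus\dots\oplus A^T$, and let $\mathcal H:\mathcal M\to\mathbb R^{d_1n\times d_2n}$ be the block Hankel operator, whose $(a,b)$ block of $\mathcal H(\widetilde X)$ is $X_{a+b-1}$ ($1\le a\le d_1$, $1\le b\le d_2$). Let $\mathcal G(\widetilde X)=\sum_{(i,j,t)\in I}\langle E_{i,j,t},\widetilde X\rangle\,\mathcal H(E_{i,j,t})/\|\mathcal H(E_{i,j,t})\|_F$. Write $\sigma_i$ for the $i$-th largest singular value; $\|\cdot\|$ is the spectral norm for matrices, and for linear operators on $\mathcal M$ or $\mathbb R^{d_1n\times d_2n}$ it is the operator norm induced by the Frobenius norm. For $\Omega\subset I$ let $P_\Omega(\widetilde X)=((X_t)_{i,j})_{(i,j,t)\in\Omega}$. A normalized sampling operator for $\Omega$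 is $\mathcal R_\Omega(L)=\sum_{(i,j,t)\in\Omega}w_{i,j,t}\langle E_{i,j,t},L\rangle E_{i,j,t}$ with either $w_{i,j,t}=n^2T/|\Omega|$ for all $(i,j,t)$, or $w_{i,j,t}=1/p_{i,j,t}$ for numbers $p_{i,j,t}\in[0,1]$ that are positive on $\Omega$. For a matrix $Z\in\mathbb R^{d_1n\times d_2n}$ of rank $r$ with compact singular value decomposition $Z=U\Sigma V^*$ let $\mathbf T_Z=\{UM_1^*+M_2V^*: M_1\in\mathbb R^{d_2n\times r},\,M_2\in\mathbb R^{d_1n\times r}\}$, and let $\mathcal P_{\mathbf T_Z}$ be the Frobenius-orthogonal projection onto it. The local RIP holds at $Z$ with constant $\alpha$ if $\|\mathcal P_{\mathbf T_Z}\mathcal G\mathcal R_\Omega\mathcal G^*\mathcal P_{\mathbf T_Z}-\mathcal P_{\mathbf T_Z}\mathcal G\mathcal G^*\mathcal P_{\mathbf T_Z}\|\le\alpha$. For $M=U\,\mathrm{dg}(\sigma)V^*$ a full singular value decomposition and $\varepsilon>0$, let $W_{M,\varepsilon}(Z)=U\Sigma_{\varepsilon,d_1}^{-1}U^*ZV\Sigma_{\varepsilon,d_2}^{-1}V^*$,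 where $\Sigma_{\varepsilon,d_1}$ and $\Sigma_{\varepsilon,d_2}$ are the diagonal matrices of sizes $d_1n$ and $d_2n$ with entries $\max(\sigma_i(M),\varepsilon)$ (and $\sigma_i(M)=0$ for $i>dn$). TOIRLS with inputs $\Omega$, $y$, $\widetilde r$, regularization parameter $\lambda=0$ and pencil parameters $d_1,d_2$ sets $\varepsilon_0=\infty$ and takes $W_0$ to be the identity; for $k=1,2,\dots$ it takes $$\widetilde X^{(k)}\in\operatorname*{argmin}_{\widetilde X\in\mathcal M,\ P_\Omega(\widetilde X)=y}\langle\widetilde X,\mathcal H^*W_{k-1}\mathcal H(\widetilde X)\rangle,\qquad \varepsilon_k=\min\big(\varepsilon_{k-1},\sigma_{\widetilde r+1}(\mathcal H(\widetilde X^{(k)}))\big),\qquad W_k=W_{\mathcal H(\widetilde X^{(k)}),\varepsilon_k};$$ if $\varepsilon_k=0$ (so that $W_k$ is not defined) the algorithm stops and $\widetilde X^{(k+1)}:=\widetilde X^{(k)}$. Proposition 7.4. There exists an absolute constant $c_0>0$ such that the following holds for all $n,d_1,d_2\ge1$ and $1\le r<dn$. Let $A\in\mathbb R^{n\times n}$ be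 of rank $r$, $\mathbf H_A=\mathcal H(\mathcal Q_T(A))$, $\kappa=\sigma_1(\mathbf H_A)/\sigma_r(\mathbf H_A)$, and let $\mathcal R_\Omega$ be a normalized sampling operator for a set $\Omega\subset I$ for which the local RIP holds at $\mathbf H_A$ with constant $\alpha=1/5$. Then there exists $\nu>0$, depending only on $A$, $d_1$, $d_2$, $\Omega$ and $\mathcal R_\Omega$, with the following property. Let $\widetilde X^{(1)},\widetilde X^{(2)},\dots$ be the iterates of TOIRLS with inputs $\Omega$, $y=P_\Omega(\mathcal Q_T(A))$, $\widetilde r=r$, $\lambda=0$, and suppose that for some $k\ge1$ we have $\varepsilon_k=\sigma_{r+1}(\mathcal H(\widetilde X^{(k)}))$ and $$\|\mathcal H(\widetilde X^{(k)})-\mathbf H_A\|\le c_0\,\|\mathcal R_\Omega\|^{-3/2}\,r^{-1}\,\kappa^{-1}\,(dn-r)^{-1/2}\,\sigma_r(\mathbf H_A).$$ Then for all $\ell\ge0$ $$\|\mathcal H(\widetilde X^{(k+\ell+1)})-\mathbf H_A\|\le\min\big(\nu\,\|\mathcal H(\widetilde X^{(k+\ell)})-\mathbf H_A\|^2,\ \|\mathcal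 H(\widetilde X^{(k+\ell)})-\mathbf H_A\|\big),$$ and $\mathcal H(\widetilde X^{(k+\ell)})\to\mathbf H_A$ as $\ell\to\infty$. -/

import Mathlib

open scoped Matrix

noncomputable section

namespace TOIRLS

/-- The direct sum `X₁ ⊕ ⋯ ⊕ X_T` of `T` real `n × n` matrices, stored through its entries
`(X_t)_{ij}`, with the Frobenius inner product and norm. -/
abbrev Blocks (n T : ℕ) : Type := EuclideanSpace ℝ (Fin n × Fin n × Fin T)

/-- Real `(d₁ n) × (d₂ n)` matrices; rows and columns are indexed by (block, place in block). -/
abbrev BlockMat (n d₁ d₂ : ℕ) : Type := Matrix (Fin d₁ × Fin n) (Fin d₂ × Fin n) ℝ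

/-- The same matrices as a Euclidean space: Frobenius inner product and norm. -/
abbrev Frob (n d₁ d₂ : ℕ) : Type :=
  EuclideanSpace ℝ ((Fin d₁ × Fin n) × (Fin d₂ × Fin n))

/-- The matrix `M`, regarded as an element of the Frobenius space. -/
def toFrob (n d₁ d₂ : ℕ) : BlockMat n d₁ d₂ ≃ₗ[ℝ] Frob n d₁ d₂ where
  toFun M := WithLp.toLp 2 fun p => M p.1 p.2
  invFun Z := Matrix.of fun a b => Z (a, b)
  map_add' _ _ := rfl
  map_smul' _ _ := rfl
  left_inv _ := rfl
  right_inv _ := rfl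

/-- The spectral norm of a real matrix: the operator norm for the Euclidean norms. -/
def specNorm {m k : Type*} [Fintype m] [Fintype k] [DecidableEq k] (M : Matrix m k ℝ) : ℝ :=
  ‖LinearMap.toContinuousLinearMap (Matrix.toEuclideanLin M)‖

/-- `sigma M i` for `i ≥ 1` is the `i`-th largest singular value of `M` (with multiplicity); it is
`0` when `i` exceeds the smaller dimension. Mathlib numbers singular values from `0`. -/
def sigma {m k : Type*} [Fintype m] [DecidableEq m] [Fintype k] [DecidableEq k]
    (M : Matrix m k ℝ) (i : ℕ) : ℝ :=
  (Matrix.toEuclideanLin M).singularValues (i - 1)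

/-- `Q_T(A) = A ⊕ A² ⊕ ⋯ ⊕ A^T` (the summand number `t : Fin T`, counted from `0`, is `A^(t+1)`). -/
def powers {n : ℕ} (T : ℕ) (A : Matrix (Fin n) (Fin n) ℝ) : Blocks n T :=
  WithLp.toLp 2 fun e => (A ^ ((e.2.2 : ℕ) + 1)) e.1 e.2.1

/-- The block Hankel operator with pencil parameters `d₁, d₂`, where `T = d₁ + d₂ - 1`: counted from
`0`, the block of `H(X)` in block row `a` and block column `b` is the summand number `a + b`. -/
def hankel (n d₁ d₂ : ℕ) : Blocks n (d₁ + d₂ - 1) →ₗ[ℝ] BlockMat n d₁ d₂ where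
  toFun X := Matrix.of fun p q =>
    X (p.2, q.2, ⟨(p.1 : ℕ) + (q.1 : ℕ), by have := p.1.isLt; have := q.1.isLt; omega⟩)
  map_add' _ _ := rfl
  map_smul' _ _ := rfl

/-- The block Hankel operator as a map into the Frobenius space. -/
def hankelF (n d₁ d₂ : ℕ) : Blocks n (d₁ + d₂ - 1) →L[ℝ] Frob n d₁ d₂ :=
  LinearMap.toContinuousLinearMap ((toFrob n d₁ d₂).toLinearMap ∘ₗ hankel n d₁ d₂)

/-- The standard basis element `E_{i,j,t}`. -/
def basisE {n T : ℕ} (e : Fin n × Fin n × Fin T) : Blocks n T := EuclideanSpace.single e 1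

/-- The normalized block Hankel operator
`G(X) = ∑_{i,j,t} ⟨E_{ijt}, X⟩ H(E_{ijt}) / ‖H(E_{ijt})‖_F`. -/
def normHankel (n d₁ d₂ : ℕ) : Blocks n (d₁ + d₂ - 1) →L[ℝ] Frob n d₁ d₂ :=
  ∑ e : Fin n × Fin n × Fin (d₁ + d₂ - 1),
    (innerSL ℝ (basisE e)).smulRight
      (‖hankelF n d₁ d₂ (basisE e)‖⁻¹ • hankelF n d₁ d₂ (basisE e))

/-- The subsampling operator `P_Ω`. -/
def sample {n T : ℕ} (Ω : Finset (Fin n × Fin n × Fin T)) (X : Blocks n T) : Ω → ℝ :=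
  fun e => X e.1

/-- `L ↦ ∑_{(i,j,t) ∈ Ω} w_{ijt} ⟨E_{ijt}, L⟩ E_{ijt}`. -/
def weightedSampling {n T : ℕ} (Ω : Finset (Fin n × Fin n × Fin T))
    (w : Fin n × Fin n × Fin T → ℝ) : Blocks n T →L[ℝ] Blocks n T :=
  ∑ e ∈ Ω, w e • (innerSL ℝ (basisE e)).smulRight (basisE e)

/-- `R` is a normalized sampling operator for the sampling set `Ω`: either the one of uniform
sampling, with weight `n² T / |Ω|`, or one of adaptive sampling, with weights `1 / p_{ijt}` for
success probabilities `p_{ijt} ∈ [0, 1]` (positive at the indices that are observed). -/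
def IsNormalizedSampling {n T : ℕ} (Ω : Finset (Fin n × Fin n × Fin T))
    (R : Blocks n T →L[ℝ] Blocks n T) : Prop :=
  R = weightedSampling Ω (fun _ => (n : ℝ) ^ 2 * (T : ℝ) / (Ω.card : ℝ)) ∨
  ∃ p : Fin n × Fin n × Fin T → ℝ, (∀ e, 0 ≤ p e ∧ p e ≤ 1) ∧ (∀ e ∈ Ω, 0 < p e) ∧
    R = weightedSampling Ω (fun e => 1 / p e)

/-- The tangent space at `Z` to the manifold of matrices of rank `rank Z`: the matrices
`Z N₁ + N₂ Z`. By `mem_tangentSpace_iff_of_compactSVD` this is `{U M₁ᵀ + M₂ Vᵀ}` for any compact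
singular value decomposition `Z = U Σ Vᵀ`. -/
def tangentSpace {n d₁ d₂ : ℕ} (Z : BlockMat n d₁ d₂) : Submodule ℝ (Frob n d₁ d₂) where
  carrier := {W | ∃ (N₁ : Matrix (Fin d₂ × Fin n) (Fin d₂ × Fin n) ℝ)
    (N₂ : Matrix (Fin d₁ × Fin n) (Fin d₁ × Fin n) ℝ), W = toFrob n d₁ d₂ (Z * N₁ + N₂ * Z)}
  add_mem' := by
    rintro _ _ ⟨N₁, N₂, rfl⟩ ⟨N₁', N₂', rfl⟩
    refine ⟨N₁ + N₁', N₂ + N₂', ?_⟩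
    rw [← map_add, Matrix.mul_add, Matrix.add_mul]
    congr 1
    abel
  zero_mem' := ⟨0, 0, by simp⟩
  smul_mem' := by
    rintro c _ ⟨N₁, N₂, rfl⟩
    exact ⟨c • N₁, c • N₂, by rw [← map_smul, smul_add, Matrix.mul_smul, Matrix.smul_mul]⟩

theorem mem_tangentSpace_iff_of_compactSVD {n d₁ d₂ r : ℕ} {Z : BlockMat n d₁ d₂}
    (U : Matrix (Fin d₁ × Fin n) (Fin r) ℝ) (V : Matrix (Fin d₂ × Fin n) (Fin r) ℝ)
    (s : Fin r → ℝ) (hs : ∀ i, 0 < s i) (hU : Uᵀ * U = 1) (hV : Vᵀ * V = 1)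
    (hZ : Z = U * Matrix.diagonal s * Vᵀ) (W : BlockMat n d₁ d₂) :
    toFrob n d₁ d₂ W ∈ tangentSpace Z ↔
      ∃ (M₁ : Matrix (Fin d₂ × Fin n) (Fin r) ℝ) (M₂ : Matrix (Fin d₁ × Fin n) (Fin r) ℝ),
        W = U * M₁ᵀ + M₂ * Vᵀ := by
  have hd : Matrix.diagonal s * Matrix.diagonal (fun i => (s i)⁻¹) = 1 := by
    rw [Matrix.diagonal_mul_diagonal, ← Matrix.diagonal_one]
    congr 1
    ext i
    exact mul_inv_cancel₀ (hs i).ne'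
  have hd' : Matrix.diagonal (fun i => (s i)⁻¹) * Matrix.diagonal s = 1 := by
    rw [Matrix.diagonal_mul_diagonal, ← Matrix.diagonal_one]
    congr 1
    ext i
    exact inv_mul_cancel₀ (hs i).ne'
  constructor
  · rintro ⟨N₁, N₂, h⟩
    refine ⟨(Matrix.diagonal s * Vᵀ * N₁)ᵀ, N₂ * U * Matrix.diagonal s, ?_⟩
    rw [(toFrob n d₁ d₂).injective h, hZ, Matrix.transpose_transpose]
    simp only [Matrix.mul_assoc]
  · rintro ⟨M₁, M₂, rfl⟩
    refine ⟨V * Matrix.diagonal (fun i => (s i)⁻¹) * M₁ᵀ,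
      M₂ * Matrix.diagonal (fun i => (s i)⁻¹) * Uᵀ, ?_⟩
    congr 1
    have h1 : Z * (V * Matrix.diagonal (fun i => (s i)⁻¹) * M₁ᵀ) = U * M₁ᵀ := by
      calc _ = U * (Matrix.diagonal s * (Vᵀ * V) * Matrix.diagonal (fun i => (s i)⁻¹)) * M₁ᵀ := by
            rw [hZ]; simp only [Matrix.mul_assoc]
        _ = _ := by rw [hV, Matrix.mul_one, hd, Matrix.mul_one]
    have h2 : M₂ * Matrix.diagonal (fun i => (s i)⁻¹) * Uᵀ * Z = M₂ * Vᵀ := by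
      calc _ = M₂ * (Matrix.diagonal (fun i => (s i)⁻¹) * (Uᵀ * U) * Matrix.diagonal s) * Vᵀ := by
            rw [hZ]; simp only [Matrix.mul_assoc]
        _ = _ := by rw [hU, Matrix.mul_one, hd', Matrix.mul_one]
    rw [h1, h2]

/-- The local restricted isometry property of `R` with respect to (the tangent space at) `Z` with
constant `α`: `‖P G R G* P - P G G* P‖ ≤ α` for the orthogonal projection `P` onto the tangent
space; the norm is the operator norm for the Frobenius norm. -/
def LocalRIP {n d₁ d₂ : ℕ}
    (R : Blocks n (d₁ + d₂ - 1) →L[ℝ] Blocks n (d₁ + d₂ - 1)) (Z : BlockMat n d₁ d₂)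
    (α : ℝ) : Prop :=
  let P : Frob n d₁ d₂ →L[ℝ] Frob n d₁ d₂ := (tangentSpace Z).starProjection
  let G := normHankel n d₁ d₂
  let Gs := ContinuousLinearMap.adjoint G
  ‖P ∘L G ∘L R ∘L Gs ∘L P - P ∘L G ∘L Gs ∘L P‖ ≤ α

/-- `M = U dg(σ₁(M), σ₂(M), …) Vᵀ` with orthogonal `U` and `V` is a (full) singular value
decomposition of `M`. -/
structure IsSVD {n d₁ d₂ : ℕ} (M : BlockMat n d₁ d₂)
    (U : Matrix (Fin d₁ × Fin n) (Fin (d₁ * n)) ℝ)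
    (V : Matrix (Fin d₂ × Fin n) (Fin (d₂ * n)) ℝ) : Prop where
  left_orth : Uᵀ * U = 1
  left_orth' : U * Uᵀ = 1
  right_orth : Vᵀ * V = 1
  right_orth' : V * Vᵀ = 1
  eq : M = U * (Matrix.of fun (i : Fin (d₁ * n)) (j : Fin (d₂ * n)) =>
    if (i : ℕ) = (j : ℕ) then sigma M ((i : ℕ) + 1) else 0) * Vᵀ

/-- The diagonal matrix `Σ_ε⁻¹`, with entries `1 / max(σ_i(M), ε)`. -/
def smoothedInv {n d₁ d₂ : ℕ} (M : BlockMat n d₁ d₂) (ε : ℝ) (N : ℕ) :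
    Matrix (Fin N) (Fin N) ℝ :=
  Matrix.diagonal fun i => (max (sigma M ((i : ℕ) + 1)) ε)⁻¹

/-- The optimal weight operator `W_M(Z) = U Σ_{ε,d₁}⁻¹ Uᵀ Z V Σ_{ε,d₂}⁻¹ Vᵀ` of `M` and `ε`, computed
from a singular value decomposition with factors `U, V` (it does not depend on the choice). -/
def weightOp {n d₁ d₂ : ℕ} (M : BlockMat n d₁ d₂) (ε : ℝ)
    (U : Matrix (Fin d₁ × Fin n) (Fin (d₁ * n)) ℝ)
    (V : Matrix (Fin d₂ × Fin n) (Fin (d₂ * n)) ℝ) : Frob n d₁ d₂ →L[ℝ] Frob n d₁ d₂ :=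
  LinearMap.toContinuousLinearMap
    { toFun := fun Z => toFrob n d₁ d₂
        (U * smoothedInv M ε (d₁ * n) * Uᵀ * (toFrob n d₁ d₂).symm Z *
          (V * smoothedInv M ε (d₂ * n) * Vᵀ))
      map_add' := by
        intro X Y
        simp only [map_add, Matrix.mul_add, Matrix.add_mul]
      map_smul' := by
        intro c X
        simp only [map_smul, Matrix.mul_smul, Matrix.smul_mul, RingHom.id_apply] }

/-- The effective weight operator `H* W H`. -/
def effective {n d₁ d₂ : ℕ} (W : Frob n d₁ d₂ →L[ℝ] Frob n d₁ d₂) :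
    Blocks n (d₁ + d₂ - 1) →L[ℝ] Blocks n (d₁ + d₂ - 1) :=
  ContinuousLinearMap.adjoint (hankelF n d₁ d₂) ∘L W ∘L hankelF n d₁ d₂

/-- `X` solves the weighted least squares problem: minimize `⟨X, W̃ X⟩` subject to `P_Ω(X) = y`
(regularization parameter `λ = 0`). -/
def IsWLSSolution {n T : ℕ} (Wt : Blocks n T →L[ℝ] Blocks n T)
    (Ω : Finset (Fin n × Fin n × Fin T)) (y : Ω → ℝ) (X : Blocks n T) : Prop :=
  sample Ω X = y ∧ ∀ Y : Blocks n T, sample Ω Y = y → inner ℝ X (Wt X) ≤ inner ℝ Y (Wt Y)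

/-- `X 1, X 2, …` are the iterates and `ε 1, ε 2, …` the smoothing parameters of a run of TOIRLS with
pencil parameters `d₁, d₂`, sampling set `Ω`, observations `y`, rank estimate `rt` and
regularization parameter `0`. The values `X 0` and `ε 0` play no role. -/
structure IsRun {n : ℕ} (d₁ d₂ : ℕ) (Ω : Finset (Fin n × Fin n × Fin (d₁ + d₂ - 1))) (y : Ω → ℝ)
    (rt : ℕ) (X : ℕ → Blocks n (d₁ + d₂ - 1)) (ε : ℕ → ℝ) : Prop where
  /-- the initial weight operator is `H* H` -/
  first : IsWLSSolution (effective (ContinuousLinearMap.id ℝ (Frob n d₁ d₂))) Ω y (X 1)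
  /-- the smoothing starts from `ε₀ = ∞`, so the first minimum is the singular value -/
  smooth_first : ε 1 = sigma (hankel n d₁ d₂ (X 1)) (rt + 1)
  smooth : ∀ k, 1 ≤ k → ε (k + 1) = min (ε k) (sigma (hankel n d₁ d₂ (X (k + 1))) (rt + 1))
  step : ∀ k, 1 ≤ k → 0 < ε k → ∃ U V, IsSVD (hankel n d₁ d₂ (X k)) U V ∧
    IsWLSSolution (effective (weightOp (hankel n d₁ d₂ (X k)) (ε k) U V)) Ω y (X (k + 1))
  /-- weight operators exist for `ε > 0` only; once `ε = 0` the run has stopped -/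
  halt : ∀ k, 1 ≤ k → ε k = 0 → X (k + 1) = X k

end TOIRLS

end

noncomputable section

namespace TOIRLS

set_option linter.unusedSectionVars false

/-! ### Spectral norm of a real matrix. -/

section Spectral

open scoped Matrix.Norms.L2Operator

variable {m k l : Type*} [Fintype m] [Fintype k] [Fintype l]
  [DecidableEq m] [DecidableEq k] [DecidableEq l]

/-! Let `M` be the Hankel matrix to be recovered, `Z` an iterate, `δ = ‖Z - M‖`, `σ = σ_r(M)`, `a =
√‖R‖`, `b = √r`, `c = √(dn - r)`, and let `Q`, `Q'` be the projections off the first `r` left and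
right singular vectors of `Z`. One step of the iteration rests on three estimates.

Null space property. If `N` vanishes on `Ω`, the images under `𝒢*` of the tangential and the normal
part of `𝓗 N` cancel on `Ω`, so sampling cannot tell their sizes apart; the local RIP at `M` then
bounds `𝓗 N` in Frobenius norm by `4a` times its normal part (`norm_hankelF_le_of_localRIP`). The
normal part of `H` is at most `(1 - M B₁) H (1 - B₂ M)` for all `B₁`, `B₂`. Inserting the truncated
pseudoinverse of `Z` turns the outer factors into `Q` and `Q'` up to errors of order `δ / σ`. Hence
`‖H‖_F ≤ 5a ‖Q H Q'‖_F` (`fro_le_of_nullSpaceProperty`), without any perturbation theory for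
singular subspaces.

Quadratic decrease. Let `H` be the error of the next iterate and `e = σ_{r+1}(Z)`, so that `e ≤ δ`
by Weyl. Optimality gives `⟨H, W H⟩ = -⟨H, W M⟩`. The left side is at least `e⁻² ‖Q H Q'‖_F²`. On
the right, `M = M B M` with `‖B‖_F ≤ b / σ`, and each of the two outer products of a weight factor
with `M` is at most `2 δ / e`, so the powers of `e` cancel. With the null space property, `‖H‖_F ≤
100 a² b δ² / σ` (`fro_le_of_optimality`).

Smoothing. The step can be repeated only if the minimum defining the next smoothing parameter is
attained by the new singular value. The null space property applied to `Z - M` gives `δ ≤ 10 a c e`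
(`specNorm_sub_le_smoothing`). By Weyl the new singular value is at most the new error, hence at
most `(1000 a³ b c δ / σ) e ≤ e` once `4000 a³ b c δ ≤ σ`. The same condition makes the error at
least halve, so it persists and the iterates converge (`IsRun.local_step`). -/

theorem specNorm_eq_norm (M : Matrix m k ℝ) : specNorm M = ‖M‖ := rfl

theorem specNorm_nonneg (M : Matrix m k ℝ) : 0 ≤ specNorm M := norm_nonneg _

theorem specNorm_add_le (M N : Matrix m k ℝ) : specNorm (M + N) ≤ specNorm M + specNorm N :=
  norm_add_le (M : Matrix m k ℝ) N

theorem specNorm_sub_le (M N : Matrix m k ℝ) : specNorm (M - N) ≤ specNorm M + specNorm N :=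
  norm_sub_le (M : Matrix m k ℝ) N

theorem specNorm_neg (M : Matrix m k ℝ) : specNorm (-M) = specNorm M :=
  norm_neg (M : Matrix m k ℝ)

theorem specNorm_transpose (M : Matrix m k ℝ) : specNorm Mᵀ = specNorm M := by
  rw [specNorm_eq_norm, specNorm_eq_norm, ← Matrix.conjTranspose_eq_transpose_of_trivial]
  exact Matrix.l2_opNorm_conjTranspose M

theorem specNorm_mul_le (M : Matrix m k ℝ) (N : Matrix k l ℝ) :
    specNorm (M * N) ≤ specNorm M * specNorm N :=
  Matrix.l2_opNorm_mul M N

theorem specNorm_transpose_mul_self (M : Matrix m k ℝ) :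
    specNorm (Mᵀ * M) = specNorm M * specNorm M := by
  rw [specNorm_eq_norm, specNorm_eq_norm, ← Matrix.conjTranspose_eq_transpose_of_trivial]
  exact Matrix.l2_opNorm_conjTranspose_mul_self M

theorem specNorm_diagonal_le {v : m → ℝ} {c : ℝ} (hc : 0 ≤ c) (h : ∀ i, |v i| ≤ c) :
    specNorm (Matrix.diagonal v) ≤ c := by
  rw [specNorm_eq_norm, Matrix.l2_opNorm_diagonal]
  exact (pi_norm_le_iff_of_nonneg hc).2 h

theorem norm_mulVec_le_specNorm (M : Matrix m k ℝ) (x : k → ℝ) :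
    ‖WithLp.toLp 2 (M *ᵥ x)‖ ≤ specNorm M * ‖WithLp.toLp 2 x‖ :=
  Matrix.l2_opNorm_mulVec M (WithLp.toLp 2 x)

theorem sum_sq_mulVec_le (M : Matrix m k ℝ) (x : k → ℝ) :
    ∑ i, (M *ᵥ x) i ^ 2 ≤ specNorm M ^ 2 * ∑ j, x j ^ 2 := by
  have h := pow_le_pow_left₀ (norm_nonneg _) (norm_mulVec_le_specNorm M x) 2
  simpa [mul_pow, EuclideanSpace.norm_sq_eq] using h

/-- A matrix with orthonormal columns has spectral norm at most one. -/
theorem specNorm_le_one_of_transpose_mul_self {U : Matrix m k ℝ} (hU : Uᵀ * U = 1) :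
    specNorm U ≤ 1 := by
  have h := specNorm_transpose_mul_self U
  rw [hU, ← Matrix.diagonal_one] at h
  have h1 : specNorm (Matrix.diagonal (fun _ : k => (1 : ℝ))) ≤ 1 :=
    specNorm_diagonal_le zero_le_one (by simp)
  nlinarith [specNorm_nonneg U]

end Spectral

/-! ### Frobenius norm and its interplay with the spectral norm. -/

section Frobenius

variable {m k l : Type*} [Fintype m] [Fintype k] [Fintype l]
  [DecidableEq m] [DecidableEq k] [DecidableEq l]

/-- The Frobenius norm of a real matrix. -/
def fro (M : Matrix m k ℝ) : ℝ := ‖(WithLp.toLp 2 fun p : m × k => M p.1 p.2)‖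

theorem fro_nonneg (M : Matrix m k ℝ) : 0 ≤ fro M := norm_nonneg _

theorem fro_add_le (M N : Matrix m k ℝ) : fro (M + N) ≤ fro M + fro N :=
  norm_add_le (WithLp.toLp 2 fun p : m × k => M p.1 p.2) (WithLp.toLp 2 fun p : m × k => N p.1 p.2)

theorem fro_sub_le (M N : Matrix m k ℝ) : fro (M - N) ≤ fro M + fro N :=
  norm_sub_le (WithLp.toLp 2 fun p : m × k => M p.1 p.2) (WithLp.toLp 2 fun p : m × k => N p.1 p.2)

theorem fro_sq (M : Matrix m k ℝ) : fro M ^ 2 = ∑ i, ∑ j, M i j ^ 2 := by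
  rw [fro, EuclideanSpace.norm_sq_eq, Fintype.sum_prod_type]
  simp

theorem fro_sq_col (M : Matrix m k ℝ) : fro M ^ 2 = ∑ j, ∑ i, M i j ^ 2 := by
  rw [fro_sq, Finset.sum_comm]

theorem fro_transpose (M : Matrix m k ℝ) : fro Mᵀ = fro M := by
  rw [← sq_eq_sq₀ (fro_nonneg _) (fro_nonneg _), fro_sq, fro_sq, Finset.sum_comm]
  rfl

theorem fro_mul_le_left (M : Matrix m k ℝ) (N : Matrix k l ℝ) :
    fro (M * N) ≤ specNorm M * fro N := by
  refine le_of_sq_le_sq ?_ (mul_nonneg (specNorm_nonneg M) (fro_nonneg N))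
  rw [mul_pow, fro_sq_col, fro_sq_col, Finset.mul_sum]
  exact Finset.sum_le_sum fun j _ => sum_sq_mulVec_le M fun t => N t j

theorem fro_mul_le_right (M : Matrix m k ℝ) (N : Matrix k l ℝ) :
    fro (M * N) ≤ fro M * specNorm N := by
  rw [← fro_transpose, Matrix.transpose_mul, mul_comm, ← fro_transpose M, ← specNorm_transpose N]
  exact fro_mul_le_left _ _

theorem specNorm_le_fro (M : Matrix m k ℝ) : specNorm M ≤ fro M := by
  refine ContinuousLinearMap.opNorm_le_bound _ (fro_nonneg M) fun x => ?_
  refine le_of_sq_le_sq ?_ (mul_nonneg (fro_nonneg M) (norm_nonneg x))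
  rw [mul_pow, fro_sq, EuclideanSpace.norm_sq_eq, EuclideanSpace.norm_sq_eq, Finset.sum_mul]
  refine Finset.sum_le_sum fun i _ => ?_
  simpa [Matrix.mulVec, dotProduct] using
    Finset.sum_mul_sq_le_sq_mul_sq Finset.univ (fun j => M i j) (fun j => x j)

theorem abs_entry_le_specNorm (M : Matrix m k ℝ) (i : m) (j : k) : |M i j| ≤ specNorm M := by
  refine abs_le_of_sq_le_sq ?_ (specNorm_nonneg M)
  have h := sum_sq_mulVec_le M (Pi.single j 1)
  simp only [Matrix.mulVec_single_one, Matrix.col_apply] at h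
  calc M i j ^ 2 ≤ ∑ i, M i j ^ 2 :=
        Finset.single_le_sum (f := fun i => M i j ^ 2) (fun _ _ => sq_nonneg _) (Finset.mem_univ i)
    _ ≤ _ := h
    _ = _ := by simp [Pi.single_apply]

theorem fro_sq_eq_trace (M : Matrix m k ℝ) : fro M ^ 2 = (Mᵀ * M).trace := by
  rw [fro_sq, Finset.sum_comm]
  simp [Matrix.trace, Matrix.mul_apply, sq]

theorem trace_transpose_mul_le (M N : Matrix m k ℝ) : |(Mᵀ * N).trace| ≤ fro M * fro N := by
  have h := abs_real_inner_le_norm (WithLp.toLp 2 fun p : m × k => M p.1 p.2)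
    (WithLp.toLp 2 fun p : m × k => N p.1 p.2)
  have h2 : (Mᵀ * N).trace = inner ℝ (WithLp.toLp 2 fun p : m × k => M p.1 p.2)
      (WithLp.toLp 2 fun p : m × k => N p.1 p.2) := by
    rw [PiLp.inner_apply, Fintype.sum_prod_type, Finset.sum_comm]
    simp [Matrix.trace, Matrix.mul_apply, mul_comm]
  rw [h2]
  exact h

end Frobenius

/-! ### Matrices that are diagonal in orthonormal frames. -/

/-- The rectangular diagonal matrix with diagonal entries `f 0, f 1, …`. -/
def rectDiag (p q : ℕ) (f : ℕ → ℝ) : Matrix (Fin p) (Fin q) ℝ :=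
  Matrix.of fun i j => if (i : ℕ) = (j : ℕ) then f i else 0

theorem rectDiag_transpose (p q : ℕ) (f : ℕ → ℝ) : (rectDiag p q f)ᵀ = rectDiag q p f := by
  ext i j
  simp only [rectDiag, Matrix.transpose_apply, Matrix.of_apply]
  grind

theorem diagonal_mul_rectDiag (p q : ℕ) (f g : ℕ → ℝ) :
    Matrix.diagonal (fun i : Fin p => f i) * rectDiag p q g = rectDiag p q fun i => f i * g i := by
  ext i j
  simp [Matrix.diagonal_mul, rectDiag]

theorem rectDiag_mul_rectDiag (p q : ℕ) (f g : ℕ → ℝ) :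
    rectDiag p q f * rectDiag q p g =
      Matrix.diagonal fun i : Fin p => if (i : ℕ) < q then f i * g i else 0 := by
  ext i j
  rw [Matrix.mul_apply, Matrix.diagonal_apply]
  by_cases hi : (i : ℕ) < q
  · rw [Finset.sum_eq_single ⟨i, hi⟩]
    · simp only [rectDiag, Matrix.of_apply, if_true, hi, Fin.ext_iff, mul_ite, mul_zero]
    · intro b _ hb
      have : (i : ℕ) ≠ b := fun h => hb (Fin.ext h.symm)
      simp [rectDiag, this]
    · simp
  · rw [Finset.sum_eq_zero]
    · simp [hi]
    · intro b _
      have : (i : ℕ) ≠ b := fun h => hi (h ▸ b.isLt)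
      simp [rectDiag, this]

theorem specNorm_rectDiag_le {p q : ℕ} {f : ℕ → ℝ} {c : ℝ} (hc : 0 ≤ c)
    (h : ∀ i, i < p → i < q → |f i| ≤ c) : specNorm (rectDiag p q f) ≤ c := by
  have h1 := specNorm_transpose_mul_self (rectDiag p q f)
  rw [rectDiag_transpose, rectDiag_mul_rectDiag] at h1
  refine le_of_sq_le_sq ?_ hc
  rw [sq, ← h1, sq]
  refine specNorm_diagonal_le (mul_nonneg hc hc) fun i => ?_
  split_ifs with hi
  · rw [abs_mul]
    have := h i hi i.isLt
    gcongr
  · simpa using mul_nonneg hc hc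

theorem fro_rectDiag_sq (p q : ℕ) (f : ℕ → ℝ) :
    fro (rectDiag p q f) ^ 2 = ∑ i ∈ Finset.range (min p q), f i ^ 2 := by
  rw [fro_sq_eq_trace, rectDiag_transpose, rectDiag_mul_rectDiag, Matrix.trace_diagonal,
    Fin.sum_univ_eq_sum_range (fun i => if i < p then f i * f i else 0) q, ← Finset.sum_filter]
  refine Finset.sum_congr ?_ fun i _ => (sq _).symm
  ext i
  simp [and_comm]

/-- Only the positions in the window `[a, b)` contribute. The window `[0, r)` serves truncated
pseudoinverses and `[r, min p q)` serves tails. -/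
theorem fro_rectDiag_le {p q : ℕ} {f : ℕ → ℝ} {a b : ℕ} {c : ℝ} (hc : 0 ≤ c)
    (h : ∀ i, |f i| ≤ c) (h0 : ∀ i, i < min p q → i ∉ Finset.Ico a b → f i = 0) :
    fro (rectDiag p q f) ≤ √((b - a : ℕ) : ℝ) * c := by
  refine le_of_sq_le_sq ?_ (by positivity)
  rw [fro_rectDiag_sq, mul_pow, Real.sq_sqrt (Nat.cast_nonneg _)]
  calc _ ≤ ∑ i ∈ Finset.Ico a b, f i ^ 2 := by
        rw [← Finset.sum_filter_of_ne (p := fun i => i ∈ Finset.Ico a b)]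
        · exact Finset.sum_le_sum_of_subset_of_nonneg (fun i hi => (Finset.mem_filter.1 hi).2)
            fun _ _ _ => sq_nonneg _
        · intro i hi hne
          by_contra hab
          exact hne (by rw [h0 i (Finset.mem_range.1 hi) hab]; simp)
    _ ≤ ∑ i ∈ Finset.Ico a b, c ^ 2 := Finset.sum_le_sum fun i _ => sq_le_sq' (abs_le.1 (h i)).1
        (abs_le.1 (h i)).2
    _ = _ := by simp

/-- `M = U dg(f) Vᵀ` with orthogonal matrices `U` and `V`. -/
structure HasSVD {m k : Type*} [Fintype m] [Fintype k] [DecidableEq m] [DecidableEq k] {p q : ℕ}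
    (M : Matrix m k ℝ) (U : Matrix m (Fin p) ℝ) (V : Matrix k (Fin q) ℝ) (f : ℕ → ℝ) : Prop where
  left_orth : Uᵀ * U = 1
  left_orth' : U * Uᵀ = 1
  right_orth : Vᵀ * V = 1
  right_orth' : V * Vᵀ = 1
  eq : M = U * rectDiag p q f * Vᵀ

section

variable {m k l : Type*} [Fintype m] [Fintype k] [Fintype l]
  [DecidableEq m] [DecidableEq k] [DecidableEq l] {p q : ℕ}

/-- The symmetric matrix with eigenvectors the columns of `U` and eigenvalues `f`. -/
def conjDiag (U : Matrix m (Fin p) ℝ) (f : ℕ → ℝ) : Matrix m m ℝ :=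
  U * Matrix.diagonal (fun i : Fin p => f i) * Uᵀ

/-- `U dg(f) Vᵀ`. -/
def svdMat (U : Matrix m (Fin p) ℝ) (V : Matrix k (Fin q) ℝ) (f : ℕ → ℝ) : Matrix m k ℝ :=
  U * rectDiag p q f * Vᵀ

theorem svdMat_transpose (U : Matrix m (Fin p) ℝ) (V : Matrix k (Fin q) ℝ) (f : ℕ → ℝ) :
    (svdMat U V f)ᵀ = svdMat V U f := by
  simp only [svdMat, Matrix.transpose_mul, Matrix.transpose_transpose, rectDiag_transpose,
    Matrix.mul_assoc]

theorem conjDiag_transpose (U : Matrix m (Fin p) ℝ) (f : ℕ → ℝ) :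
    (conjDiag U f)ᵀ = conjDiag U f := by
  simp only [conjDiag, Matrix.transpose_mul, Matrix.transpose_transpose, Matrix.diagonal_transpose,
    Matrix.mul_assoc]

theorem conjDiag_mul_svdMat {U : Matrix m (Fin p) ℝ} (hU : Uᵀ * U = 1) (V : Matrix k (Fin q) ℝ)
    (f g : ℕ → ℝ) : conjDiag U f * svdMat U V g = svdMat U V fun i => f i * g i := by
  calc _ = U * (Matrix.diagonal (fun i : Fin p => f i) * (Uᵀ * U) * rectDiag p q g) * Vᵀ := by
        simp only [conjDiag, svdMat, Matrix.mul_assoc]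
    _ = _ := by rw [hU, Matrix.mul_one, diagonal_mul_rectDiag, svdMat]

theorem svdMat_mul_conjDiag (U : Matrix m (Fin p) ℝ) {V : Matrix k (Fin q) ℝ} (hV : Vᵀ * V = 1)
    (f g : ℕ → ℝ) : svdMat U V f * conjDiag V g = svdMat U V fun i => g i * f i := by
  rw [← Matrix.transpose_inj, Matrix.transpose_mul, conjDiag_transpose, svdMat_transpose,
    svdMat_transpose, conjDiag_mul_svdMat hV]

theorem conjDiag_mul_conjDiag {U : Matrix m (Fin p) ℝ} (hU : Uᵀ * U = 1) (f g : ℕ → ℝ) :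
    conjDiag U f * conjDiag U g = conjDiag U fun i => f i * g i := by
  calc _ = U * (Matrix.diagonal (fun i : Fin p => f i) * (Uᵀ * U) *
          Matrix.diagonal (fun i : Fin p => g i)) * Uᵀ := by
        simp only [conjDiag, Matrix.mul_assoc]
    _ = _ := by rw [hU, Matrix.mul_one, Matrix.diagonal_mul_diagonal, conjDiag]

theorem svdMat_mul_svdMat (U : Matrix m (Fin p) ℝ) {V : Matrix k (Fin q) ℝ} (hV : Vᵀ * V = 1)
    (f g : ℕ → ℝ) :
    svdMat U V f * svdMat V U g = conjDiag U fun i => if i < q then f i * g i else 0 := by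
  calc _ = U * (rectDiag p q f * (Vᵀ * V) * rectDiag q p g) * Uᵀ := by
        simp only [svdMat, Matrix.mul_assoc]
    _ = _ := by rw [hV, Matrix.mul_one, rectDiag_mul_rectDiag, conjDiag]

theorem one_sub_conjDiag {U : Matrix m (Fin p) ℝ} (hU : U * Uᵀ = 1) (f : ℕ → ℝ) :
    1 - conjDiag U f = conjDiag U fun i => 1 - f i := by
  have : Matrix.diagonal (fun i : Fin p => 1 - f i) =
      1 - Matrix.diagonal (fun i : Fin p => f i) := by
    rw [← Matrix.diagonal_one, Matrix.diagonal_sub]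
  simp only [conjDiag, this, Matrix.mul_sub, Matrix.sub_mul, Matrix.mul_one, hU]

theorem specNorm_mul_mul_transpose_le {U : Matrix m (Fin p) ℝ} (hU : Uᵀ * U = 1)
    {V : Matrix k (Fin q) ℝ} (hV : Vᵀ * V = 1) (D : Matrix (Fin p) (Fin q) ℝ) :
    specNorm (U * D * Vᵀ) ≤ specNorm D := by
  have h1 := specNorm_le_one_of_transpose_mul_self hU
  have h2 := specNorm_le_one_of_transpose_mul_self hV
  have h3 := specNorm_nonneg D
  calc _ ≤ specNorm (U * D) * specNorm Vᵀ := specNorm_mul_le _ _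
    _ ≤ (specNorm U * specNorm D) * specNorm V := by
        rw [specNorm_transpose]
        exact mul_le_mul_of_nonneg_right (specNorm_mul_le _ _) (specNorm_nonneg _)
    _ ≤ (1 * specNorm D) * 1 := by
        have := specNorm_nonneg V
        gcongr
    _ = _ := by ring

theorem fro_mul_mul_transpose_le {U : Matrix m (Fin p) ℝ} (hU : Uᵀ * U = 1)
    {V : Matrix k (Fin q) ℝ} (hV : Vᵀ * V = 1) (D : Matrix (Fin p) (Fin q) ℝ) :
    fro (U * D * Vᵀ) ≤ fro D := by
  have h1 := specNorm_le_one_of_transpose_mul_self hU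
  have h2 := specNorm_le_one_of_transpose_mul_self hV
  have h3 := fro_nonneg D
  calc _ ≤ fro (U * D) * specNorm Vᵀ := fro_mul_le_right _ _
    _ ≤ (specNorm U * fro D) * specNorm V := by
        rw [specNorm_transpose]
        exact mul_le_mul_of_nonneg_right (fro_mul_le_left _ _) (specNorm_nonneg _)
    _ ≤ (1 * fro D) * 1 := by
        have := specNorm_nonneg V
        gcongr
    _ = _ := by ring

theorem specNorm_svdMat_le {U : Matrix m (Fin p) ℝ} (hU : Uᵀ * U = 1)
    {V : Matrix k (Fin q) ℝ} (hV : Vᵀ * V = 1) {f : ℕ → ℝ} {c : ℝ} (hc : 0 ≤ c)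
    (h : ∀ i, |f i| ≤ c) : specNorm (svdMat U V f) ≤ c :=
  (specNorm_mul_mul_transpose_le hU hV _).trans (specNorm_rectDiag_le hc fun i _ _ => h i)

theorem specNorm_conjDiag_le {U : Matrix m (Fin p) ℝ} (hU : Uᵀ * U = 1) {f : ℕ → ℝ} {c : ℝ}
    (hc : 0 ≤ c) (h : ∀ i, |f i| ≤ c) : specNorm (conjDiag U f) ≤ c :=
  (specNorm_mul_mul_transpose_le hU hU _).trans (specNorm_diagonal_le hc fun i => h i)

theorem fro_svdMat_le {U : Matrix m (Fin p) ℝ} (hU : Uᵀ * U = 1)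
    {V : Matrix k (Fin q) ℝ} (hV : Vᵀ * V = 1) {f : ℕ → ℝ} {a b : ℕ} {c : ℝ} (hc : 0 ≤ c)
    (h : ∀ i, |f i| ≤ c) (h0 : ∀ i, i < min p q → i ∉ Finset.Ico a b → f i = 0) :
    fro (svdMat U V f) ≤ √((b - a : ℕ) : ℝ) * c :=
  (fro_mul_mul_transpose_le hU hV _).trans (fro_rectDiag_le hc h h0)

end

/-! ### Existence of singular value decompositions and Weyl's inequality. -/

section

variable {m k : Type*} [Fintype m] [Fintype k] [DecidableEq m] [DecidableEq k] {p q : ℕ}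

/-- The matrix whose columns are the vectors of an orthonormal basis is orthogonal. -/
theorem orthogonal_of_orthonormalBasis (b : OrthonormalBasis (Fin p) ℝ (EuclideanSpace ℝ m)) :
    (Matrix.of fun a i => b i a)ᵀ * (Matrix.of fun a i => b i a : Matrix m (Fin p) ℝ) = 1 ∧
    (Matrix.of fun a i => b i a : Matrix m (Fin p) ℝ) * (Matrix.of fun a i => b i a)ᵀ = 1 := by
  have hp : Fintype.card m = Fintype.card (Fin p) := by
    rw [← finrank_euclideanSpace (𝕜 := ℝ) (ι := m), Module.finrank_eq_card_basis b.toBasis]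
  have h : (Matrix.of fun a i => b i a)ᵀ * (Matrix.of fun a i => b i a : Matrix m (Fin p) ℝ) = 1 := by
    ext i j
    have := orthonormal_iff_ite.1 b.orthonormal i j
    rw [PiLp.inner_apply] at this
    simp only [Matrix.mul_apply, Matrix.transpose_apply, Matrix.of_apply, Matrix.one_apply, ← this]
    simp [mul_comm]
  exact ⟨h, (Matrix.mul_eq_one_comm_of_equiv (Fintype.equivOfCardEq hp.symm)).1 h⟩

/-- The right singular vectors are an eigenbasis of `Tᵀ T`; their images under `T` are orthogonal,
with squared lengths the eigenvalues. The normalized nonzero images extend to an orthonormal basis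
on the left. -/
theorem exists_hasSVD (hp : Fintype.card m = p) (hq : Fintype.card k = q) (M : Matrix m k ℝ) :
    ∃ (U : Matrix m (Fin p) ℝ) (V : Matrix k (Fin q) ℝ), HasSVD M U V fun i => sigma M (i + 1) := by
  set T := Matrix.toEuclideanLin M with hT
  have hk : Module.finrank ℝ (EuclideanSpace ℝ k) = q := by rw [finrank_euclideanSpace, hq]
  have hm : Module.finrank ℝ (EuclideanSpace ℝ m) = p := by rw [finrank_euclideanSpace, hp]
  have hsym := T.isSymmetric_adjoint_comp_self
  set b := hsym.eigenvectorBasis hk with hb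
  have hin : ∀ i j, inner ℝ (T (b i)) (T (b j)) = if i = j then T.singularValues i ^ 2 else 0 := by
    intro i j
    have h1 : LinearMap.adjoint T (T (b i)) = (T.singularValues i ^ 2) • b i := by
      have := hsym.apply_eigenvectorBasis hk i
      rw [← T.sq_singularValues_fin hk i] at this
      exact this
    rw [← LinearMap.adjoint_inner_left, h1, inner_smul_left, orthonormal_iff_ite.1 b.orthonormal]
    simp
  let u : Fin p → EuclideanSpace ℝ m := fun i =>
    if h : (i : ℕ) < q then (T.singularValues i)⁻¹ • T (b ⟨i, h⟩) else 0
  let s : Set (Fin p) := {i | (i : ℕ) < q ∧ T.singularValues i ≠ 0}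
  have hu : Orthonormal ℝ (s.domRestrict u) := by
    rw [orthonormal_iff_ite]
    rintro ⟨i, hi, hi0⟩ ⟨j, hj, hj0⟩
    have hin' : ∀ (a b' : Fin p) (ha : (a : ℕ) < q) (hb : (b' : ℕ) < q),
        inner ℝ (u a) (u b') = if a = b' then
          (T.singularValues a)⁻¹ * ((T.singularValues a)⁻¹ * T.singularValues a ^ 2) else 0 := by
      intro a b' ha hb
      simp only [u, dif_pos ha, dif_pos hb, inner_smul_left, inner_smul_right, hin, Fin.ext_iff,
        conj_trivial]
      split_ifs with h
      · rw [h]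
      · simp
    change inner ℝ (u i) (u j) = _
    rw [hin' i j hi hj]
    simp only [Subtype.mk.injEq]
    split_ifs
    · field_simp
    · rfl
  obtain ⟨c, hc⟩ := hu.exists_orthonormalBasis_extension_of_card_eq (by simp [hm])
  have hTb : ∀ j : Fin q, ∀ h : (j : ℕ) < p, T (b j) = T.singularValues j • c ⟨j, h⟩ := by
    intro j h
    by_cases h0 : T.singularValues j = 0
    · have : inner ℝ (T (b j)) (T (b j)) = (0 : ℝ) := by rw [hin]; simp [h0]
      rw [inner_self_eq_zero.1 this, h0, zero_smul]
    · rw [hc ⟨j, h⟩ ⟨j.isLt, h0⟩]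
      simp [u, smul_smul, h0]
  -- An index beyond the number of rows exceeds the rank, so its singular value vanishes.
  have hTb' : ∀ j : Fin q, ¬ (j : ℕ) < p → T (b j) = 0 := by
    intro j h
    have h0 : T.singularValues j = 0 := by
      rw [T.singularValues_eq_zero_iff_le_finrank_range]
      exact (Submodule.finrank_le _).trans (by rw [hm]; omega)
    have : inner ℝ (T (b j)) (T (b j)) = (0 : ℝ) := by rw [hin]; simp [h0]
    exact inner_self_eq_zero.1 this
  obtain ⟨hU, hU'⟩ := orthogonal_of_orthonormalBasis c
  obtain ⟨hV, hV'⟩ := orthogonal_of_orthonormalBasis b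
  refine ⟨_, _, hU, hU', hV, hV', ?_⟩
  have key : M * (Matrix.of fun a i => b i a : Matrix k (Fin q) ℝ) =
      (Matrix.of fun a i => c i a : Matrix m (Fin p) ℝ) *
        rectDiag p q fun i => sigma M (i + 1) := by
    ext a j
    have h1 : (M * (Matrix.of fun a i => b i a : Matrix k (Fin q) ℝ)) a j = T (b j) a := by
      simp [T, Matrix.mul_apply, Matrix.mulVec, dotProduct]
    rw [h1, Matrix.mul_apply]
    by_cases hj : (j : ℕ) < p
    · rw [hTb j hj, Finset.sum_eq_single ⟨j, hj⟩]
      · simp [rectDiag, sigma, T, mul_comm]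
      · intro i _ hi
        have : (i : ℕ) ≠ j := fun h => hi (Fin.ext h)
        simp [rectDiag, this]
      · simp
    · rw [hTb' j hj, Finset.sum_eq_zero]
      · simp
      · intro i _
        have : (i : ℕ) ≠ j := fun h => hj (h ▸ i.isLt)
        simp [rectDiag, this]
  rw [← key, Matrix.mul_assoc, hV', Matrix.mul_one]

theorem norm_toLp_sq (v : k → ℝ) : ‖WithLp.toLp 2 v‖ ^ 2 = ∑ a, v a ^ 2 := by
  simp [EuclideanSpace.norm_sq_eq]

theorem sum_sq_mulVec_eq (M : Matrix m k ℝ) (x : k → ℝ) :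
    ∑ i, (M *ᵥ x) i ^ 2 = x ⬝ᵥ ((Mᵀ * M) *ᵥ x) := by
  have h : (M *ᵥ x) ⬝ᵥ (M *ᵥ x) = x ⬝ᵥ ((Mᵀ * M) *ᵥ x) := by
    rw [← Matrix.mulVec_mulVec, Matrix.dotProduct_mulVec x, Matrix.vecMul_transpose]
  rw [← h]
  simp [dotProduct, sq]

theorem sum_sq_mulVec_of_orth {U : Matrix m k ℝ} (hU : Uᵀ * U = 1) (x : k → ℝ) :
    ∑ i, (U *ᵥ x) i ^ 2 = ∑ i, x i ^ 2 := by
  rw [sum_sq_mulVec_eq, hU, Matrix.one_mulVec]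
  simp [dotProduct, sq]

theorem sum_sq_rectDiag_mulVec (f : ℕ → ℝ) (x : Fin q → ℝ) :
    ∑ i, (rectDiag p q f *ᵥ x) i ^ 2 =
      ∑ j : Fin q, (if (j : ℕ) < p then f j ^ 2 else 0) * x j ^ 2 := by
  rw [sum_sq_mulVec_eq, rectDiag_transpose, rectDiag_mul_rectDiag]
  refine Finset.sum_congr rfl fun j _ => ?_
  rw [Matrix.mulVec_diagonal]
  split_ifs <;> ring

namespace HasSVD

variable {M M' : Matrix m k ℝ} {U U' : Matrix m (Fin p) ℝ} {V V' : Matrix k (Fin q) ℝ}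
  {f g : ℕ → ℝ}

theorem sum_sq_mulVec (h : HasSVD M U V f) (x : k → ℝ) :
    ∑ i, (M *ᵥ x) i ^ 2 =
      ∑ j : Fin q, (if (j : ℕ) < p then f j ^ 2 else 0) * (Vᵀ *ᵥ x) j ^ 2 := by
  rw [h.eq, ← Matrix.mulVec_mulVec, ← Matrix.mulVec_mulVec, sum_sq_mulVec_of_orth h.left_orth,
    sum_sq_rectDiag_mulVec]

/-- Weyl's inequality for singular values. -/
theorem le_add_specNorm_sub (h : HasSVD M U V f) (h' : HasSVD M' U' V' g) (hf : Antitone f)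
    (hf0 : ∀ i, 0 ≤ f i) (hg : Antitone g) (hg0 : ∀ i, 0 ≤ g i) {i : ℕ} (hp : i < p) (hq : i < q) :
    f i ≤ g i + specNorm (M - M') := by
  -- Dimension count by a determinant. The rows below `i` ask that `V y` be orthogonal to the first
  -- `i` right singular vectors of `M'`, the rows above `i` that `y` live on the first `i + 1`
  -- coordinates. Row `i` is zero, so a nonzero solution `y` exists; along `V y`, `M` stretches by
  -- at least `f i` and `M'` by at most `g i`.
  let A : Matrix (Fin q) (Fin q) ℝ := Matrix.of fun a b =>
    if (a : ℕ) < i then (V'ᵀ * V) a b else if (a : ℕ) = i then 0 else (1 : Matrix _ _ ℝ) a b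
  have hA : A.det = 0 := Matrix.det_eq_zero_of_row_eq_zero ⟨i, hq⟩ fun j => by simp [A]
  obtain ⟨y, hy0, hy⟩ := Matrix.exists_mulVec_eq_zero_iff.2 hA
  have hAy : ∀ a : Fin q, (A *ᵥ y) a =
      if (a : ℕ) < i then ((V'ᵀ * V) *ᵥ y) a else if (a : ℕ) = i then 0 else y a := by
    intro a
    have hsum : (A *ᵥ y) a = ∑ j, A a j * y j := rfl
    split_ifs with h1 h2
    · refine hsum.trans (Finset.sum_congr rfl fun j _ => ?_)
      simp only [A, Matrix.of_apply, if_pos h1]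
    · rw [hsum]
      simp [A, h2]
    · rw [hsum]
      simp [A, h1, h2, Matrix.one_apply]
  have hy1 : ∀ a : Fin q, i < a → y a = 0 := by
    intro a ha
    have := hAy a
    rw [hy, if_neg ha.not_gt, if_neg ha.ne'] at this
    exact this.symm
  have hz1 : ∀ a : Fin q, (a : ℕ) < i → (V'ᵀ *ᵥ (V *ᵥ y)) a = 0 := by
    intro a ha
    have := hAy a
    rw [hy, if_pos ha] at this
    rw [Matrix.mulVec_mulVec]
    exact this.symm
  set Y := ∑ j, y j ^ 2 with hYdef
  have hY : 0 < Y := by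
    obtain ⟨j, hj⟩ := Function.ne_iff.1 hy0
    exact Finset.sum_pos' (fun _ _ => sq_nonneg _) ⟨j, Finset.mem_univ j, by
      have : y j ≠ 0 := hj
      positivity⟩
  set x := V *ᵥ y with hx
  have hxY : ∑ j, x j ^ 2 = Y := sum_sq_mulVec_of_orth h.right_orth y
  have hzY : ∑ j, (V'ᵀ *ᵥ x) j ^ 2 = Y := by
    rw [sum_sq_mulVec_of_orth (by rw [Matrix.transpose_transpose, h'.right_orth']), hxY]
  have h1 : f i ^ 2 * Y ≤ ∑ a, (M *ᵥ x) a ^ 2 := by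
    rw [h.sum_sq_mulVec, hx, Matrix.mulVec_mulVec, h.right_orth, Matrix.one_mulVec, hYdef,
      Finset.mul_sum]
    refine Finset.sum_le_sum fun j _ => ?_
    by_cases hj : i < j
    · simp [hy1 j hj]
    · rw [if_pos (by omega)]
      exact mul_le_mul_of_nonneg_right (pow_le_pow_left₀ (hf0 i) (hf (by omega)) 2) (sq_nonneg _)
  have h2 : ∑ a, (M' *ᵥ x) a ^ 2 ≤ g i ^ 2 * Y := by
    rw [h'.sum_sq_mulVec, ← hzY, Finset.mul_sum]
    refine Finset.sum_le_sum fun j _ => ?_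
    by_cases hj : (j : ℕ) < i
    · simp [hz1 j hj]
    · refine mul_le_mul_of_nonneg_right ?_ (sq_nonneg _)
      split_ifs
      · exact pow_le_pow_left₀ (hg0 j) (hg (by omega)) 2
      · positivity
  have hsx : ‖WithLp.toLp 2 x‖ = √Y := by
    rw [← hxY, ← norm_toLp_sq, Real.sqrt_sq (norm_nonneg _)]
  have h3 : f i * √Y ≤ ‖WithLp.toLp 2 (M *ᵥ x)‖ := by
    refine le_of_sq_le_sq ?_ (norm_nonneg _)
    rw [norm_toLp_sq, mul_pow, Real.sq_sqrt hY.le]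
    exact h1
  have h4 : ‖WithLp.toLp 2 (M' *ᵥ x)‖ ≤ g i * √Y := by
    refine le_of_sq_le_sq ?_ (mul_nonneg (hg0 i) (Real.sqrt_nonneg _))
    rw [norm_toLp_sq, mul_pow, Real.sq_sqrt hY.le]
    exact h2
  have h5 := norm_mulVec_le_specNorm (M - M') x
  have h6 : WithLp.toLp 2 (M *ᵥ x) = WithLp.toLp 2 (M' *ᵥ x) + WithLp.toLp 2 ((M - M') *ᵥ x) := by
    rw [← WithLp.toLp_add, Matrix.sub_mulVec]
    simp
  have h7 := norm_add_le (WithLp.toLp 2 (M' *ᵥ x)) (WithLp.toLp 2 ((M - M') *ᵥ x))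
  rw [← h6] at h7
  rw [hsx] at h5
  refine le_of_mul_le_mul_right ?_ (Real.sqrt_pos.2 hY)
  linarith

end HasSVD

end

/-! ### Tail projections, truncated pseudoinverses and smoothed weights. -/

section

variable {m k : Type*} [Fintype m] [Fintype k] [DecidableEq m] [DecidableEq k] {p q : ℕ}

/-- The projection onto the span of all columns of `U` but the first `r`. -/
def tailProj (U : Matrix m (Fin p) ℝ) (r : ℕ) : Matrix m m ℝ :=
  conjDiag U fun i => if i < r then 0 else 1

/-- The pseudoinverse of the truncation to rank `r` of `U dg(f) Vᵀ`. -/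
def truncPinv (U : Matrix m (Fin p) ℝ) (V : Matrix k (Fin q) ℝ) (f : ℕ → ℝ) (r : ℕ) :
    Matrix k m ℝ :=
  svdMat V U fun i => if i < r then (f i)⁻¹ else 0

theorem specNorm_tailProj_le {U : Matrix m (Fin p) ℝ} (hU : Uᵀ * U = 1) (r : ℕ) :
    specNorm (tailProj U r) ≤ 1 :=
  specNorm_conjDiag_le hU zero_le_one fun i => by split_ifs <;> simp

theorem fro_triple_le {l o : Type*} [Fintype l] [Fintype o] [DecidableEq l] [DecidableEq o]
    (L : Matrix l m ℝ) (M : Matrix m k ℝ) (N : Matrix k o ℝ) {x y : ℝ} (hL : specNorm L ≤ x)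
    (hN : specNorm N ≤ y) : fro (L * M * N) ≤ x * fro M * y := by
  have h1 := fro_mul_le_right (L * M) N
  have h2 := fro_mul_le_left L M
  have h3 := specNorm_nonneg L
  have h4 := specNorm_nonneg N
  have h5 := fro_nonneg M
  calc _ ≤ fro (L * M) * specNorm N := h1
    _ ≤ (specNorm L * fro M) * specNorm N := by gcongr
    _ ≤ _ := by gcongr; exact mul_nonneg (h3.trans hL) h5

namespace HasSVD

variable {Z : Matrix m k ℝ} {U : Matrix m (Fin p) ℝ} {V : Matrix k (Fin q) ℝ} {f : ℕ → ℝ} {r : ℕ}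

theorem eq_svdMat (h : HasSVD Z U V f) : Z = svdMat U V f := h.eq

theorem transpose (h : HasSVD Z U V f) : HasSVD Zᵀ V U f :=
  ⟨h.right_orth, h.right_orth', h.left_orth, h.left_orth', by
    rw [h.eq_svdMat, svdMat_transpose]; rfl⟩

/-- The truncated pseudoinverse is a right inverse up to rank `r`, provided the first `r` singular values do not vanish. -/
theorem one_sub_mul_truncPinv (h : HasSVD Z U V f) (hr : r ≤ q) (hf : ∀ i, i < r → f i ≠ 0) :
    1 - Z * truncPinv U V f r = tailProj U r := by
  rw [h.eq_svdMat, truncPinv, svdMat_mul_svdMat U h.right_orth, one_sub_conjDiag h.left_orth',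
    tailProj]
  congr 1
  ext i
  by_cases hi : i < r
  · simp [hi, hi.trans_le hr, hf i hi]
  · simp [hi]

theorem truncPinv_transpose : (truncPinv U V f r)ᵀ = truncPinv V U f r := svdMat_transpose _ _ _

theorem one_sub_truncPinv_mul (h : HasSVD Z U V f) (hr : r ≤ p) (hf : ∀ i, i < r → f i ≠ 0) :
    1 - truncPinv U V f r * Z = tailProj V r := by
  have := h.transpose.one_sub_mul_truncPinv hr hf
  rw [← Matrix.transpose_inj, Matrix.transpose_sub, Matrix.transpose_mul, truncPinv_transpose,
    Matrix.transpose_one, this, tailProj, conjDiag_transpose]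

theorem specNorm_truncPinv_le (h : HasSVD Z U V f) {s : ℝ} (hs : 0 < s)
    (hf : ∀ i, i < r → s ≤ f i) : specNorm (truncPinv U V f r) ≤ s⁻¹ := by
  refine specNorm_svdMat_le h.right_orth h.left_orth (by positivity) fun i => ?_
  split_ifs with hi
  · have h1 := hf i hi
    rw [abs_of_pos (by have := hs.trans_le h1; positivity)]
    gcongr
  · simpa using hs.le

theorem fro_truncPinv_le (h : HasSVD Z U V f) {s : ℝ} (hs : 0 < s)
    (hf : ∀ i, i < r → s ≤ f i) : fro (truncPinv U V f r) ≤ √r * s⁻¹ := by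
  have := fro_svdMat_le (f := fun i => if i < r then (f i)⁻¹ else 0) (a := 0) (b := r) (c := s⁻¹)
    h.right_orth h.left_orth (by positivity) (fun i => ?_) (fun i _ hi => ?_)
  · simpa [truncPinv] using this
  · split_ifs with hi
    · have h1 := hf i hi
      rw [abs_of_pos (by have := hs.trans_le h1; positivity)]
      gcongr
    · simpa using hs.le
  · simp only [Finset.mem_Ico, zero_le, true_and] at hi
    simp [hi]

/-- If the rank is `r`, then the truncated pseudoinverse is a pseudoinverse. -/
theorem mul_truncPinv_mul (h : HasSVD Z U V f) (hr : r ≤ q) (hf : ∀ i, i < r → f i ≠ 0)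
    (hf' : ∀ i, r ≤ i → f i = 0) : Z * truncPinv U V f r * Z = Z := by
  have h1 : tailProj U r * Z = 0 := by
    rw [h.eq_svdMat, tailProj, conjDiag_mul_svdMat h.left_orth]
    have : (fun i => (if i < r then 0 else 1) * f i) = fun _ => (0 : ℝ) := by
      ext i
      by_cases hi : i < r
      · simp [hi]
      · simp [hi, hf' i (not_lt.1 hi)]
    rw [this, svdMat]
    have : rectDiag p q (fun _ => 0) = 0 := by ext i j; simp [rectDiag]
    simp [this]
  rw [← h.one_sub_mul_truncPinv hr hf, Matrix.sub_mul, Matrix.one_mul, sub_eq_zero] at h1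
  exact h1.symm

theorem specNorm_tailProj_mul_le (h : HasSVD Z U V f) {e : ℝ} (he : 0 ≤ e)
    (hf0 : ∀ i, 0 ≤ f i) (hf : ∀ i, r ≤ i → f i ≤ e) : specNorm (tailProj U r * Z) ≤ e := by
  rw [h.eq_svdMat, tailProj, conjDiag_mul_svdMat h.left_orth]
  refine specNorm_svdMat_le h.left_orth h.right_orth he fun i => ?_
  split_ifs with hi
  · simpa using he
  · rw [one_mul, abs_of_nonneg (hf0 i)]
    exact hf i (not_lt.1 hi)

theorem specNorm_mul_tailProj_le (h : HasSVD Z U V f) {e : ℝ} (he : 0 ≤ e)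
    (hf0 : ∀ i, 0 ≤ f i) (hf : ∀ i, r ≤ i → f i ≤ e) : specNorm (Z * tailProj V r) ≤ e := by
  rw [← specNorm_transpose, Matrix.transpose_mul, tailProj, conjDiag_transpose]
  exact h.transpose.specNorm_tailProj_mul_le he hf0 hf

theorem fro_tailProj_mul_tailProj_le (h : HasSVD Z U V f) {e : ℝ} (he : 0 ≤ e)
    (hf0 : ∀ i, 0 ≤ f i) (hf : ∀ i, r ≤ i → f i ≤ e) :
    fro (tailProj U r * Z * tailProj V r) ≤ √((min p q - r : ℕ) : ℝ) * e := by
  rw [h.eq_svdMat, tailProj, tailProj, conjDiag_mul_svdMat h.left_orth,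
    svdMat_mul_conjDiag _ h.right_orth]
  refine fro_svdMat_le h.left_orth h.right_orth he (fun i => ?_) fun i hi1 hi2 => ?_
  · split_ifs with hi
    · simpa using he
    · rw [one_mul, one_mul, abs_of_nonneg (hf0 i)]
      exact hf i (not_lt.1 hi)
  · have : i < r := by
      by_contra hc
      exact hi2 (Finset.mem_Ico.2 ⟨not_lt.1 hc, hi1⟩)
    simp [this]

/-- The left factor of the smoothed weight operator. -/
theorem specNorm_smoothed_le (h : HasSVD Z U V f) {e : ℝ} (he : 0 < e) :
    specNorm (conjDiag U fun i => (max (f i) e)⁻¹) ≤ e⁻¹ := by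
  refine specNorm_conjDiag_le h.left_orth (by positivity) fun i => ?_
  have h1 : e ≤ max (f i) e := le_max_right _ _
  rw [abs_of_pos (by positivity)]
  gcongr

/-- The product has the singular values `f i / max (f i) e`. This is why the weight stays harmless
on `Z` itself, however small `e` is. -/
theorem specNorm_smoothed_mul_le (h : HasSVD Z U V f) (hf0 : ∀ i, 0 ≤ f i) {e : ℝ} (he : 0 < e) :
    specNorm ((conjDiag U fun i => (max (f i) e)⁻¹) * Z) ≤ 1 := by
  rw [h.eq_svdMat, conjDiag_mul_svdMat h.left_orth]
  refine specNorm_svdMat_le h.left_orth h.right_orth zero_le_one fun i => ?_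
  have h1 : 0 < max (f i) e := he.trans_le (le_max_right _ _)
  rw [abs_of_nonneg (mul_nonneg (by positivity) (hf0 i)), inv_mul_le_iff₀ h1, mul_one]
  exact le_max_left _ _

theorem specNorm_mul_smoothed_le (h : HasSVD Z U V f) (hf0 : ∀ i, 0 ≤ f i) {e : ℝ} (he : 0 < e) :
    specNorm (Z * (conjDiag V fun i => (max (f i) e)⁻¹)) ≤ 1 := by
  rw [← specNorm_transpose, Matrix.transpose_mul, conjDiag_transpose]
  exact h.transpose.specNorm_smoothed_mul_le hf0 he

/-- From index `r` on, the maximum equals `e`, so on the tail the square root of the weight is the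
scalar `1 / √e`. -/
theorem tailProj_eq_smul_mul_sqrt (hU : Uᵀ * U = 1) {e : ℝ} (he : 0 < e)
    (hf : ∀ i, r ≤ i → f i ≤ e) :
    tailProj U r = √e • (tailProj U r * conjDiag U fun i => √(max (f i) e)⁻¹) := by
  have hsm : ∀ (c : ℝ) (g : ℕ → ℝ), c • conjDiag U g = conjDiag U fun i => c * g i := by
    intro c g
    have : Matrix.diagonal (fun i : Fin p => c * g i) =
        c • Matrix.diagonal (fun i : Fin p => g i) := by
      rw [← Matrix.diagonal_smul]; rfl
    rw [conjDiag, conjDiag, this, Matrix.mul_smul, Matrix.smul_mul]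
  rw [tailProj, conjDiag_mul_conjDiag hU, hsm]
  congr 1
  ext i
  by_cases hi : i < r
  · simp [hi]
  · rw [if_neg hi, max_eq_right (hf i (not_lt.1 hi)), one_mul, ← Real.sqrt_mul he.le,
      mul_inv_cancel₀ he.ne', Real.sqrt_one]

theorem smoothed_eq_sqrt_mul_sqrt (hU : Uᵀ * U = 1) {e : ℝ} (he : 0 < e) :
    conjDiag U (fun i => (max (f i) e)⁻¹) =
      (conjDiag U fun i => √(max (f i) e)⁻¹) * conjDiag U fun i => √(max (f i) e)⁻¹ := by
  rw [conjDiag_mul_conjDiag hU]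
  congr 1
  ext i
  have h1 : 0 < max (f i) e := he.trans_le (le_max_right _ _)
  rw [Real.mul_self_sqrt (by positivity)]

theorem smul_sqrt_mul_tailProj (hV : Vᵀ * V = 1) {e : ℝ} (he : 0 < e)
    (hf : ∀ i, r ≤ i → f i ≤ e) :
    tailProj V r = √e • ((conjDiag V fun i => √(max (f i) e)⁻¹) * tailProj V r) := by
  have h := congrArg Matrix.transpose (tailProj_eq_smul_mul_sqrt hV he hf)
  rwa [Matrix.transpose_smul, Matrix.transpose_mul, conjDiag_transpose, tailProj,
    conjDiag_transpose] at h

theorem fro_smul_sq (c : ℝ) (M : Matrix m k ℝ) : fro (c • M) ^ 2 = c ^ 2 * fro M ^ 2 := by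
  simp only [fro_sq, Matrix.smul_apply, smul_eq_mul, mul_pow, Finset.mul_sum]

/-- With `A` and `B` the square roots of the two weight factors, the quadratic form is `‖A H B‖_F²`,
while `P H P' = e P (A H B) P'`. -/
theorem fro_sq_le_of_factor {A P : Matrix m m ℝ} {B P' : Matrix k k ℝ} {e : ℝ} (he : 0 < e)
    (hA : Aᵀ = A) (hB : Bᵀ = B) (hP : P = √e • (P * A)) (hP' : P' = √e • (B * P'))
    (hP1 : specNorm P ≤ 1) (hP1' : specNorm P' ≤ 1) (H : Matrix m k ℝ) :
    fro (P * H * P') ^ 2 ≤ e ^ 2 * (Hᵀ * ((A * A) * H * (B * B))).trace := by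
  have h1 : (Hᵀ * ((A * A) * H * (B * B))).trace = fro (A * H * B) ^ 2 := by
    rw [fro_sq_eq_trace, Matrix.transpose_mul, Matrix.transpose_mul, hA, hB]
    calc _ = ((Hᵀ * (A * (A * H)) * B) * B).trace := by simp only [Matrix.mul_assoc]
      _ = (B * (Hᵀ * (A * (A * H)) * B)).trace := Matrix.trace_mul_comm _ _
      _ = _ := by simp only [Matrix.mul_assoc]
  have h2 : P * H * P' = e • (P * (A * H * B) * P') := by
    calc P * H * P' = (√e • (P * A)) * H * (√e • (B * P')) := by rw [← hP, ← hP']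
      _ = _ := by
        rw [Matrix.smul_mul, Matrix.smul_mul, Matrix.mul_smul, smul_smul, Real.mul_self_sqrt he.le]
        simp only [Matrix.mul_assoc]
  rw [h1, h2, fro_smul_sq]
  have h4 := fro_triple_le P (A * H * B) P' hP1 hP1'
  rw [one_mul, mul_one] at h4
  exact mul_le_mul_of_nonneg_left (pow_le_pow_left₀ (fro_nonneg _) h4 2) (sq_nonneg e)

/-- The quadratic form of the weight operator controls the part off the singular spaces. -/
theorem fro_tailProj_sq_le (h : HasSVD Z U V f) {e : ℝ} (he : 0 < e)
    (hf : ∀ i, r ≤ i → f i ≤ e) (H : Matrix m k ℝ) :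
    fro (tailProj U r * H * tailProj V r) ^ 2 ≤ e ^ 2 *
      (Hᵀ * (conjDiag U (fun i => (max (f i) e)⁻¹) * H *
        conjDiag V (fun i => (max (f i) e)⁻¹))).trace := by
  rw [smoothed_eq_sqrt_mul_sqrt h.left_orth he, smoothed_eq_sqrt_mul_sqrt h.right_orth he]
  exact fro_sq_le_of_factor he (conjDiag_transpose _ _) (conjDiag_transpose _ _)
    (tailProj_eq_smul_mul_sqrt h.left_orth he hf) (smul_sqrt_mul_tailProj h.right_orth he hf)
    (specNorm_tailProj_le h.left_orth r) (specNorm_tailProj_le h.right_orth r) H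

end HasSVD

end

/-! ### Estimates for one iteration, independent of the measurements. -/

section

variable {m k : Type*} [Fintype m] [Fintype k] [DecidableEq m] [DecidableEq k] {p q : ℕ}
  {M Z H : Matrix m k ℝ} {U : Matrix m (Fin p) ℝ} {V : Matrix k (Fin q) ℝ} {f : ℕ → ℝ} {r : ℕ}

/-- Transfer of the null space property from the tangent space at `M` to the one at the truncation
to rank `r` of a nearby matrix `Z`. The number `a` stands for `√‖R‖`. -/
theorem fro_le_of_nullSpaceProperty (h : HasSVD Z U V f) (hp : r ≤ p) (hq : r ≤ q) {s a : ℝ}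
    (hs : 0 < s) (hf : ∀ i, i < r → s ≤ f i) (ha : 0 ≤ a)
    (hnsp : ∀ (B₁ B₂ : Matrix k m ℝ), fro H ≤ 4 * a * fro ((1 - M * B₁) * H * (1 - B₂ * M)))
    (hsmall : 60 * (a * specNorm (Z - M)) ≤ s) (hsmall' : specNorm (Z - M) ≤ s) :
    fro H ≤ 5 * a * fro (tailProj U r * H * tailProj V r) := by
  have hf0 : ∀ i, i < r → f i ≠ 0 := fun i hi => (hs.trans_le (hf i hi)).ne'
  set C := truncPinv U V f r with hC
  set N := Z - M with hN
  have hCn : specNorm C ≤ s⁻¹ := h.specNorm_truncPinv_le hs hf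
  -- Since `M = Z - N` and `1 - Z C` is exactly the tail projection of `Z`, replacing `Z` by `M`
  -- costs only `N C`, of norm at most `τ`.
  have hQ : 1 - M * C = tailProj U r + N * C := by
    rw [← h.one_sub_mul_truncPinv hq hf0, hN, Matrix.sub_mul]
    abel
  have hQ' : 1 - C * M = tailProj V r + C * N := by
    rw [← h.one_sub_truncPinv_mul hp hf0, hN, Matrix.mul_sub]
    abel
  set τ := specNorm N * s⁻¹ with hτ
  have hδ := specNorm_nonneg N
  have hτ0 : 0 ≤ τ := by positivity
  have hτ1 : τ ≤ 1 := by
    rw [hτ, ← div_eq_mul_inv, div_le_one hs]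
    exact hsmall'
  have hτ2 : 60 * (a * τ) ≤ 1 := by
    have : 60 * (a * τ) = 60 * (a * specNorm N) / s := by rw [hτ]; ring
    rw [this, div_le_one hs]
    exact hsmall
  have hNC : specNorm (N * C) ≤ τ := (specNorm_mul_le _ _).trans (by rw [hτ]; gcongr)
  have hCN : specNorm (C * N) ≤ τ := by
    refine (specNorm_mul_le _ _).trans ?_
    rw [hτ, mul_comm]
    gcongr
  have hQ1 := specNorm_tailProj_le h.left_orth r
  have hQ1' := specNorm_tailProj_le h.right_orth r
  have hexp : (1 - M * C) * H * (1 - C * M) = tailProj U r * H * tailProj V r +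
      (N * C * H * tailProj V r + (tailProj U r + N * C) * H * (C * N)) := by
    rw [hQ, hQ']
    simp only [Matrix.add_mul, Matrix.mul_add]
    abel
  have h1 := fro_triple_le (N * C) H (tailProj V r) hNC hQ1'
  have h2 := fro_triple_le (tailProj U r + N * C) H (C * N)
    ((specNorm_add_le _ _).trans (add_le_add hQ1 hNC)) hCN
  have h3 := hnsp C C
  rw [hexp] at h3
  have h4 := fro_add_le (tailProj U r * H * tailProj V r)
    (N * C * H * tailProj V r + (tailProj U r + N * C) * H * (C * N))
  have h5 := fro_add_le (N * C * H * tailProj V r) ((tailProj U r + N * C) * H * (C * N))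
  have hH := fro_nonneg H
  set X := fro (tailProj U r * H * tailProj V r) with hX
  -- The error terms cost `τ + (1 + τ) τ ≤ 3 τ`. As `60 a τ ≤ 1`, the resulting `12 a τ ‖H‖_F` is at
  -- most a fifth of `‖H‖_F` and is absorbed on the left, turning `4 a` into `5 a`.
  have h6 : fro H ≤ 4 * a * (X + 3 * τ * fro H) := by
    refine h3.trans ?_
    gcongr
    have : τ * τ * fro H ≤ τ * fro H := by
      have := mul_le_mul_of_nonneg_right hτ1 (mul_nonneg hτ0 hH)
      nlinarith
    nlinarith
  have h7 : 12 * (a * τ) * fro H ≤ 1 / 5 * fro H := by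
    gcongr
    linarith
  nlinarith

/-- The smoothing parameter controls the distance to `M`, up to a quadratic term. -/
theorem fro_tailProj_sub_le (h : HasSVD Z U V f) (hf0 : ∀ i, 0 ≤ f i) {e : ℝ} (he : 0 ≤ e)
    (hf : ∀ i, r ≤ i → f i ≤ e) (heδ : e ≤ specNorm (Z - M)) {B : Matrix k m ℝ}
    (hB : M * B * M = M) :
    fro (tailProj U r * (Z - M) * tailProj V r) ≤
      √((min p q - r : ℕ) : ℝ) * e + 4 * specNorm (Z - M) ^ 2 * fro B := by
  set δ := specNorm (Z - M) with hδ
  have hδ0 : 0 ≤ δ := specNorm_nonneg _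
  have hQ1 := specNorm_tailProj_le h.left_orth r
  have hQ1' := specNorm_tailProj_le h.right_orth r
  -- The tail of `Z` has norm at most `e ≤ δ`, and `Z - M` adds another `δ`.
  have h1 : specNorm (tailProj U r * M) ≤ 2 * δ := by
    have : tailProj U r * M = tailProj U r * Z - tailProj U r * (Z - M) := by
      rw [Matrix.mul_sub]; abel
    rw [this]
    have h2 := h.specNorm_tailProj_mul_le he hf0 hf
    have h3 : specNorm (tailProj U r * (Z - M)) ≤ 1 * δ :=
      (specNorm_mul_le _ _).trans (by gcongr)
    have := specNorm_sub_le (tailProj U r * Z) (tailProj U r * (Z - M))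
    linarith
  have h1' : specNorm (M * tailProj V r) ≤ 2 * δ := by
    have : M * tailProj V r = Z * tailProj V r - (Z - M) * tailProj V r := by
      rw [Matrix.sub_mul]; abel
    rw [this]
    have h2 := h.specNorm_mul_tailProj_le he hf0 hf
    have h3 : specNorm ((Z - M) * tailProj V r) ≤ δ * 1 :=
      (specNorm_mul_le _ _).trans (by gcongr)
    have := specNorm_sub_le (Z * tailProj V r) ((Z - M) * tailProj V r)
    linarith
  -- Writing `M = M B M` puts a tail projection next to each outer copy of `M`, which makes this
  -- term quadratic in `δ`.
  have h4 : tailProj U r * (Z - M) * tailProj V r = tailProj U r * Z * tailProj V r -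
      tailProj U r * M * B * (M * tailProj V r) := by
    have : tailProj U r * M * B * (M * tailProj V r) =
        tailProj U r * (M * B * M) * tailProj V r := by simp only [Matrix.mul_assoc]
    rw [this, hB, Matrix.mul_sub, Matrix.sub_mul]
  rw [h4]
  refine (fro_sub_le _ _).trans (add_le_add (h.fro_tailProj_mul_tailProj_le he hf0 hf) ?_)
  refine (fro_triple_le _ B _ h1 h1').trans (le_of_eq ?_)
  ring

/-- A solution of the weighted least squares problem is close to `M` off the singular spaces. -/
theorem fro_tailProj_sq_le_of_optimality (h : HasSVD Z U V f) (hf0 : ∀ i, 0 ≤ f i) {e : ℝ}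
    (he : 0 < e) (hf : ∀ i, r ≤ i → f i ≤ e) (heδ : e ≤ specNorm (Z - M)) {B : Matrix k m ℝ}
    (hB : M * B * M = M)
    (hopt : (Hᵀ * (conjDiag U (fun i => (max (f i) e)⁻¹) * (M + H) *
        conjDiag V (fun i => (max (f i) e)⁻¹))).trace = 0) :
    fro (tailProj U r * H * tailProj V r) ^ 2 ≤ 4 * specNorm (Z - M) ^ 2 * fro B * fro H := by
  set δ := specNorm (Z - M) with hδ
  have hδ0 : 0 ≤ δ := specNorm_nonneg _
  set L := conjDiag U (fun i => (max (f i) e)⁻¹) with hL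
  set K := conjDiag V (fun i => (max (f i) e)⁻¹) with hK
  have hL1 : specNorm L ≤ e⁻¹ := h.specNorm_smoothed_le he
  have hK1 : specNorm K ≤ e⁻¹ := h.transpose.specNorm_smoothed_le he
  -- This absorbs the bound `1` for `L Z` and `Z K` into `δ / e`.
  have hone : 1 ≤ δ * e⁻¹ := by rw [← div_eq_mul_inv, one_le_div he]; exact heδ
  have h1 : specNorm (L * M) ≤ 2 * (δ * e⁻¹) := by
    have : L * M = L * Z - L * (Z - M) := by rw [Matrix.mul_sub]; abel
    rw [this]
    have h2 := h.specNorm_smoothed_mul_le hf0 he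
    have h3 : specNorm (L * (Z - M)) ≤ e⁻¹ * δ := (specNorm_mul_le _ _).trans (by gcongr)
    have := specNorm_sub_le (L * Z) (L * (Z - M))
    rw [← hL] at h2
    linarith
  have h1' : specNorm (M * K) ≤ 2 * (δ * e⁻¹) := by
    have : M * K = Z * K - (Z - M) * K := by rw [Matrix.sub_mul]; abel
    rw [this]
    have h2 := h.specNorm_mul_smoothed_le hf0 he
    have h3 : specNorm ((Z - M) * K) ≤ δ * e⁻¹ := (specNorm_mul_le _ _).trans (by gcongr)
    have := specNorm_sub_le (Z * K) ((Z - M) * K)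
    rw [← hK] at h2
    linarith
  have h4 : fro (L * M * K) ≤ 2 * (δ * e⁻¹) * fro B * (2 * (δ * e⁻¹)) := by
    have : L * M * K = L * M * B * (M * K) := by
      calc L * M * K = L * (M * B * M) * K := by rw [hB]
        _ = _ := by simp only [Matrix.mul_assoc]
    rw [this]
    exact fro_triple_le _ B _ h1 h1'
  -- Optimality trades the quadratic form in `H` for its pairing with the weighted `M`;
  -- Cauchy–Schwarz follows.
  have h5 : (Hᵀ * (L * H * K)).trace ≤ fro H * fro (L * M * K) := by
    have h6 : (Hᵀ * (L * H * K)).trace = -(Hᵀ * (L * M * K)).trace := by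
      rw [Matrix.mul_add, Matrix.add_mul, Matrix.mul_add, Matrix.trace_add] at hopt
      linarith
    rw [h6]
    exact (neg_le_abs _).trans (trace_transpose_mul_le _ _)
  have hH := fro_nonneg H
  refine (h.fro_tailProj_sq_le he hf H).trans ?_
  calc _ ≤ e ^ 2 * (fro H * (2 * (δ * e⁻¹) * fro B * (2 * (δ * e⁻¹)))) := by
        gcongr
        exact h5.trans (by gcongr)
    _ = _ := by field_simp; ring

end

/-- Everything in a step of the iteration that does not involve the measurements: `M` is the matrix
to be recovered, `Z` the current iterate, and `a`, `b`, `c` stand for the square roots of `‖R‖`, of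
the rank and of the corank. -/
theorem specNorm_sub_le_smoothing {m k : Type*} [Fintype m] [Fintype k] [DecidableEq m]
    [DecidableEq k] {p q r : ℕ} {M Z : Matrix m k ℝ} {U : Matrix m (Fin p) ℝ}
    {V : Matrix k (Fin q) ℝ} {f : ℕ → ℝ} (h : HasSVD Z U V f) (hf0 : ∀ i, 0 ≤ f i)
    (hf : Antitone f) (hp : r ≤ p) (hq : r ≤ q) {a b c σ : ℝ} (ha : 1 ≤ a) (hb : 1 ≤ b)
    (hc : √((min p q - r : ℕ) : ℝ) ≤ c) (hσ : 0 < σ) {B : Matrix k m ℝ} (hB : M * B * M = M)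
    (hBf : fro B ≤ b * σ⁻¹) (hw : σ - specNorm (Z - M) ≤ f (r - 1)) (hw' : f r ≤ specNorm (Z - M))
    (hnsp : ∀ (B₁ B₂ : Matrix k m ℝ),
      fro (Z - M) ≤ 4 * a * fro ((1 - M * B₁) * (Z - M) * (1 - B₂ * M)))
    (hδ : 4000 * (a * b * specNorm (Z - M)) ≤ σ) :
    specNorm (Z - M) ≤ 10 * a * c * f r := by
  set δ := specNorm (Z - M) with hδdef
  have hδ0 : 0 ≤ δ := specNorm_nonneg _
  have haδ : a * δ ≤ a * b * δ := by
    have := mul_le_mul_of_nonneg_left hb (mul_nonneg (zero_le_one.trans ha) hδ0)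
    nlinarith
  have hδa : δ ≤ a * δ := le_mul_of_one_le_left hδ0 ha
  -- Indices of `f` start at `0`: `f (r - 1)` is the `r`-th singular value of `Z`, at least `σ - δ`
  -- by Weyl, and `f r` is the smoothing parameter.
  have h1 := fro_le_of_nullSpaceProperty (s := σ - δ) h hp hq (by nlinarith)
    (fun i hi => hw.trans (hf (by omega))) (zero_le_one.trans ha) hnsp (by linarith) (by linarith)
  have h2 := fro_tailProj_sub_le h hf0 (hf0 r) (fun i hi => hf hi) hw' hB
  have h3 := specNorm_le_fro (Z - M)
  have h4 : 4 * δ ^ 2 * fro B ≤ 4 * δ ^ 2 * (b * σ⁻¹) := by gcongr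
  -- The quadratic term is at most `δ / 200`, so it is absorbed by the left side of `h7`.
  have h5 : 5 * a * (4 * δ ^ 2 * (b * σ⁻¹)) ≤ δ / 200 := by
    have : 5 * a * (4 * δ ^ 2 * (b * σ⁻¹)) = (4000 * (a * b * δ)) / σ * (δ / 200) := by
      field_simp; ring
    rw [this]
    exact mul_le_of_le_one_left (by positivity) ((div_le_one hσ).2 hδ)
  have h6 : √((min p q - r : ℕ) : ℝ) * f r ≤ c * f r := mul_le_mul_of_nonneg_right hc (hf0 r)
  have h7 : δ ≤ 5 * a * (c * f r + 4 * δ ^ 2 * (b * σ⁻¹)) :=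
    h3.trans (h1.trans (by gcongr; linarith))
  nlinarith

/-- The null space property bounds `‖H‖_F²` by `25 a²` times the squared tail, and optimality bounds
that tail linearly in `‖H‖_F`. One factor `‖H‖_F` cancels, leaving `25 · 4 = 100`. -/
theorem fro_le_of_optimality {m k : Type*} [Fintype m] [Fintype k] [DecidableEq m]
    [DecidableEq k] {p q r : ℕ} {M Z H : Matrix m k ℝ} {U : Matrix m (Fin p) ℝ}
    {V : Matrix k (Fin q) ℝ} {f : ℕ → ℝ} (h : HasSVD Z U V f) (hf0 : ∀ i, 0 ≤ f i)
    (hf : Antitone f) (hp : r ≤ p) (hq : r ≤ q) {a b σ : ℝ} (ha : 1 ≤ a) (hb : 1 ≤ b)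
    (hσ : 0 < σ) {B : Matrix k m ℝ} (hB : M * B * M = M)
    (hBf : fro B ≤ b * σ⁻¹) (hw : σ - specNorm (Z - M) ≤ f (r - 1)) (hw' : f r ≤ specNorm (Z - M))
    (hnsp : ∀ (B₁ B₂ : Matrix k m ℝ),
      fro H ≤ 4 * a * fro ((1 - M * B₁) * H * (1 - B₂ * M)))
    (hδ : 4000 * (a * b * specNorm (Z - M)) ≤ σ) (he : 0 < f r)
    (hopt : (Hᵀ * (conjDiag U (fun i => (max (f i) (f r))⁻¹) * (M + H) *
        conjDiag V (fun i => (max (f i) (f r))⁻¹))).trace = 0) :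
    fro H ≤ 100 * a ^ 2 * b * σ⁻¹ * specNorm (Z - M) ^ 2 := by
  set δ := specNorm (Z - M) with hδdef
  have hδ0 : 0 ≤ δ := specNorm_nonneg _
  have haδ : a * δ ≤ a * b * δ := by
    have := mul_le_mul_of_nonneg_left hb (mul_nonneg (zero_le_one.trans ha) hδ0)
    nlinarith
  have hδa : δ ≤ a * δ := le_mul_of_one_le_left hδ0 ha
  have h1 := fro_le_of_nullSpaceProperty (s := σ - δ) h hp hq (by nlinarith)
    (fun i hi => hw.trans (hf (by omega))) (zero_le_one.trans ha) hnsp (by linarith) (by linarith)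
  have h2 := fro_tailProj_sq_le_of_optimality h hf0 he (fun i hi => hf hi) hw' hB hopt
  have hH := fro_nonneg H
  have h3 : fro H ^ 2 ≤ (100 * a ^ 2 * b * σ⁻¹ * δ ^ 2) * fro H :=
    calc fro H ^ 2 ≤ (5 * a * fro (tailProj U r * H * tailProj V r)) ^ 2 := by gcongr
      _ = 25 * a ^ 2 * fro (tailProj U r * H * tailProj V r) ^ 2 := by ring
      _ ≤ 25 * a ^ 2 * (4 * δ ^ 2 * (b * σ⁻¹) * fro H) := by
        gcongr
        exact h2.trans (by gcongr)
      _ = _ := by ring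
  rcases hH.eq_or_lt with h0 | h0
  · rw [← h0]; positivity
  · rw [sq] at h3
    exact le_of_mul_le_mul_right h3 h0

/-! ### The block Hankel operators, sampling, and the consequences of the local RIP. -/

section

variable {n d₁ d₂ : ℕ}

/-- The entry of the direct sum that the block Hankel operator puts at a given position. -/
def hankelIndex (p : (Fin d₁ × Fin n) × (Fin d₂ × Fin n)) : Fin n × Fin n × Fin (d₁ + d₂ - 1) :=
  (p.1.2, p.2.2, ⟨(p.1.1 : ℕ) + (p.2.1 : ℕ), by
    have := p.1.1.isLt; have := p.2.1.isLt; omega⟩)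

theorem hankelF_apply (X : Blocks n (d₁ + d₂ - 1)) (p : (Fin d₁ × Fin n) × (Fin d₂ × Fin n)) :
    hankelF n d₁ d₂ X p = X (hankelIndex p) := rfl

theorem norm_toFrob (M : BlockMat n d₁ d₂) : ‖toFrob n d₁ d₂ M‖ = fro M := rfl

theorem hankelF_eq (X : Blocks n (d₁ + d₂ - 1)) :
    hankelF n d₁ d₂ X = toFrob n d₁ d₂ (hankel n d₁ d₂ X) := rfl

theorem toFrob_apply (M : BlockMat n d₁ d₂) (p : (Fin d₁ × Fin n) × (Fin d₂ × Fin n)) :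
    toFrob n d₁ d₂ M p = M p.1 p.2 := rfl

theorem inner_toFrob (M N : BlockMat n d₁ d₂) :
    inner ℝ (toFrob n d₁ d₂ M) (toFrob n d₁ d₂ N) = (Mᵀ * N).trace := by
  rw [PiLp.inner_apply, Fintype.sum_prod_type, Finset.sum_comm]
  simp [Matrix.trace, Matrix.mul_apply, mul_comm, toFrob_apply]

theorem hankelIndex_surjective (hd₁ : 0 < d₁) (hd₂ : 0 < d₂) :
    Function.Surjective (hankelIndex : (Fin d₁ × Fin n) × (Fin d₂ × Fin n) → _) := by
  rintro ⟨i, j, t⟩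
  have ht := t.isLt
  refine ⟨((⟨min (t : ℕ) (d₁ - 1), by omega⟩, i), (⟨(t : ℕ) - min (t : ℕ) (d₁ - 1), by omega⟩, j)), ?_⟩
  simp only [hankelIndex, Prod.mk.injEq, true_and, Fin.ext_iff]
  omega

theorem inner_hankelF_basisE (e e' : Fin n × Fin n × Fin (d₁ + d₂ - 1)) (h : e ≠ e') :
    inner ℝ (hankelF n d₁ d₂ (basisE e)) (hankelF n d₁ d₂ (basisE e')) = 0 := by
  rw [PiLp.inner_apply]
  refine Finset.sum_eq_zero fun p _ => ?_
  rw [hankelF_apply, hankelF_apply]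
  by_cases hp : hankelIndex p = e
  · have : hankelIndex p ≠ e' := fun h' => h (hp ▸ h')
    simp [basisE, this]
  · simp [basisE, hp]

theorem hankelF_basisE_ne_zero (hd₁ : 0 < d₁) (hd₂ : 0 < d₂)
    (e : Fin n × Fin n × Fin (d₁ + d₂ - 1)) : hankelF n d₁ d₂ (basisE e) ≠ 0 := by
  intro h
  obtain ⟨p, hp⟩ := hankelIndex_surjective hd₁ hd₂ e
  have := congrArg (fun Y : Frob n d₁ d₂ => Y p) h
  rw [hankelF_apply, hp] at this
  simp [basisE] at this

/-- Distinct basis elements fill disjoint sets of positions, and every one fills at least one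
position. Hence `normHankel` is an isometry. -/
theorem orthonormal_normalized_hankelF_basisE (hd₁ : 0 < d₁) (hd₂ : 0 < d₂) :
    Orthonormal ℝ fun e : Fin n × Fin n × Fin (d₁ + d₂ - 1) =>
      ‖hankelF n d₁ d₂ (basisE e)‖⁻¹ • hankelF n d₁ d₂ (basisE e) := by
  refine ⟨fun e => ?_, fun e e' h => ?_⟩
  · exact norm_smul_inv_norm (𝕜 := ℝ) (hankelF_basisE_ne_zero hd₁ hd₂ e)
  · simp [inner_smul_left, inner_smul_right, inner_hankelF_basisE e e' h]

theorem normHankel_apply (X : Blocks n (d₁ + d₂ - 1)) :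
    normHankel n d₁ d₂ X =
      ∑ e, X e • (‖hankelF n d₁ d₂ (basisE e)‖⁻¹ • hankelF n d₁ d₂ (basisE e)) := by
  simp [normHankel, basisE, EuclideanSpace.inner_single_left]

theorem inner_normHankel (hd₁ : 0 < d₁) (hd₂ : 0 < d₂) (X Y : Blocks n (d₁ + d₂ - 1)) :
    inner ℝ (normHankel n d₁ d₂ X) (normHankel n d₁ d₂ Y) = inner ℝ X Y := by
  rw [normHankel_apply, normHankel_apply,
    (orthonormal_normalized_hankelF_basisE hd₁ hd₂).inner_sum, PiLp.inner_apply]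
  simp [mul_comm]

theorem norm_normHankel (hd₁ : 0 < d₁) (hd₂ : 0 < d₂) (X : Blocks n (d₁ + d₂ - 1)) :
    ‖normHankel n d₁ d₂ X‖ = ‖X‖ := by
  rw [← sq_eq_sq₀ (norm_nonneg _) (norm_nonneg _), ← real_inner_self_eq_norm_sq,
    ← real_inner_self_eq_norm_sq, inner_normHankel hd₁ hd₂]

theorem adjoint_normHankel_normHankel (hd₁ : 0 < d₁) (hd₂ : 0 < d₂) (X : Blocks n (d₁ + d₂ - 1)) :
    ContinuousLinearMap.adjoint (normHankel n d₁ d₂) (normHankel n d₁ d₂ X) = X := by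
  refine ext_inner_right ℝ fun Y => ?_
  rw [ContinuousLinearMap.adjoint_inner_left, inner_normHankel hd₁ hd₂]

theorem norm_adjoint_normHankel_le (hd₁ : 0 < d₁) (hd₂ : 0 < d₂) (Y : Frob n d₁ d₂) :
    ‖ContinuousLinearMap.adjoint (normHankel n d₁ d₂) Y‖ ≤ ‖Y‖ := by
  have h1 : ‖ContinuousLinearMap.adjoint (normHankel n d₁ d₂)‖ ≤ 1 := by
    rw [LinearIsometryEquiv.norm_map]
    exact ContinuousLinearMap.opNorm_le_bound _ zero_le_one fun X => by
      rw [norm_normHankel hd₁ hd₂, one_mul]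
  exact (ContinuousLinearMap.le_of_opNorm_le _ h1 Y).trans (by rw [one_mul])

/-- The Hankel operator is the normalized one after a diagonal rescaling. The rescaling preserves
vanishing on `Ω`, so both facts available for `normHankel`, isometry and RIP, apply to images of
`hankelF`. -/
theorem hankelF_eq_normHankel (hd₁ : 0 < d₁) (hd₂ : 0 < d₂) (X : Blocks n (d₁ + d₂ - 1)) :
    hankelF n d₁ d₂ X = normHankel n d₁ d₂
      (WithLp.toLp 2 fun e => ‖hankelF n d₁ d₂ (basisE e)‖ * X e) := by
  have hX : X = ∑ e, X e • basisE e := by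
    ext e
    simp [basisE, Finset.sum_apply, Pi.single_apply]
  rw [normHankel_apply]
  conv_lhs => rw [hX, map_sum]
  refine Finset.sum_congr rfl fun e _ => ?_
  have := norm_ne_zero_iff.2 (hankelF_basisE_ne_zero hd₁ hd₂ e)
  rw [map_smul, smul_smul]
  congr 1
  field_simp

theorem inner_weightedSampling {T : ℕ} (Ω : Finset (Fin n × Fin n × Fin T))
    (w : Fin n × Fin n × Fin T → ℝ) (X : Blocks n T) :
    inner ℝ X (weightedSampling Ω w X) = ∑ e ∈ Ω, w e * X e ^ 2 := by
  simp only [weightedSampling, _root_.sum_apply, inner_sum]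
  refine Finset.sum_congr rfl fun e _ => ?_
  simp [basisE, EuclideanSpace.inner_single_left, EuclideanSpace.inner_single_right,
    inner_smul_right, -mul_eq_mul_left_iff]
  ring

/-- Both kinds of sampling have weights at least `1` on `Ω`: `|Ω| ≤ n² T` in the uniform case, `p ≤
1` in the adaptive one. This gives `‖R‖ ≥ 1` when `Ω` is nonempty. -/
theorem exists_weights {T : ℕ} {Ω : Finset (Fin n × Fin n × Fin T)}
    {R : Blocks n T →L[ℝ] Blocks n T} (h : IsNormalizedSampling Ω R) :
    ∃ w, R = weightedSampling Ω w ∧ ∀ e ∈ Ω, 1 ≤ w e := by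
  rcases h with h | ⟨p, hp, hp', h⟩
  · refine ⟨_, h, fun e he => ?_⟩
    have h1 : (Ω.card : ℝ) ≤ (n : ℝ) ^ 2 * T := by
      have := Finset.card_le_univ Ω
      simp only [Fintype.card_prod, Fintype.card_fin] at this
      calc (Ω.card : ℝ) ≤ ((n * (n * T) : ℕ) : ℝ) := by exact_mod_cast this
        _ = _ := by push_cast; ring
    have h2 : (0 : ℝ) < Ω.card := by exact_mod_cast Finset.card_pos.2 ⟨e, he⟩
    rwa [one_le_div h2]
  · exact ⟨_, h, fun e he => (one_le_div (hp' e he)).2 (hp e).2⟩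

theorem one_le_norm_weightedSampling {T : ℕ} {Ω : Finset (Fin n × Fin n × Fin T)}
    {w : Fin n × Fin n × Fin T → ℝ} (hw : ∀ e ∈ Ω, 1 ≤ w e) (hΩ : Ω.Nonempty) :
    1 ≤ ‖weightedSampling Ω w‖ := by
  obtain ⟨e, he⟩ := hΩ
  have h1 : ‖(basisE e : Blocks n T)‖ = 1 := by simp [basisE]
  have h2 : w e ≤ inner ℝ (basisE e) (weightedSampling Ω w (basisE e)) := by
    rw [inner_weightedSampling]
    have h3 : w e = w e * (basisE e : Blocks n T) e ^ 2 := by simp [basisE]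
    rw [h3]
    exact Finset.single_le_sum
      (f := fun e' => w e' * (basisE e : Blocks n T) e' ^ 2)
      (fun e' he' => mul_nonneg (zero_le_one.trans (hw e' he')) (sq_nonneg _)) he
  calc 1 ≤ w e := hw e he
    _ ≤ _ := h2
    _ ≤ ‖(basisE e : Blocks n T)‖ * ‖weightedSampling Ω w (basisE e)‖ := real_inner_le_norm _ _
    _ ≤ _ := by
      have := (weightedSampling Ω w).le_opNorm (basisE e)
      rw [h1] at this ⊢
      linarith

/-- The local RIP implies a null space property relative to the tangent space. -/
theorem norm_hankelF_le_of_localRIP (hd₁ : 0 < d₁) (hd₂ : 0 < d₂)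
    {Ω : Finset (Fin n × Fin n × Fin (d₁ + d₂ - 1))}
    {w : Fin n × Fin n × Fin (d₁ + d₂ - 1) → ℝ} {Z : BlockMat n d₁ d₂}
    (h : LocalRIP (weightedSampling Ω w) Z (1 / 5)) {X : Blocks n (d₁ + d₂ - 1)}
    (hX : ∀ e ∈ Ω, X e = 0) :
    ‖hankelF n d₁ d₂ X‖ ≤ 2 * (1 + √‖weightedSampling Ω w‖) *
      ‖hankelF n d₁ d₂ X - (tangentSpace Z).starProjection (hankelF n d₁ d₂ X)‖ := by
  set R := weightedSampling Ω w with hR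
  set P := (tangentSpace Z).starProjection with hP
  set G := normHankel n d₁ d₂ with hG
  set Gs := ContinuousLinearMap.adjoint G with hGs
  set H := hankelF n d₁ d₂ X with hH
  set y := H - P H with hy
  have hPx : P (P H) = P H := by
    rw [hP]
    exact Submodule.starProjection_eq_self_iff.2 (Submodule.starProjection_apply_mem _ _)
  have hsum : Gs (P H) + Gs y = Gs H := by rw [← map_add, hy]; congr 1; abel
  have hH1 : H = G (WithLp.toLp 2 fun e => ‖hankelF n d₁ d₂ (basisE e)‖ * X e) :=
    hankelF_eq_normHankel hd₁ hd₂ X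
  have hGH : Gs H = WithLp.toLp 2 fun e => ‖hankelF n d₁ d₂ (basisE e)‖ * X e := by
    conv_lhs => rw [hH1]
    exact adjoint_normHankel_normHankel hd₁ hd₂ _
  have hnorm : ‖Gs H‖ = ‖H‖ := by
    conv_rhs => rw [hH1]
    rw [norm_normHankel hd₁ hd₂, hGH]
  -- On `Ω` the two parts sum to zero, so their entries differ only in sign.
  have hΩ : ∀ e ∈ Ω, Gs (P H) e ^ 2 = Gs y e ^ 2 := by
    intro e he
    have h1 := congrArg (fun Y : Blocks n (d₁ + d₂ - 1) => Y e) hsum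
    simp only [hGH, PiLp.add_apply, hX e he, mul_zero] at h1
    rw [eq_neg_of_add_eq_zero_left h1, neg_sq]
  have h1 : inner ℝ (Gs (P H)) (R (Gs (P H))) = inner ℝ (Gs y) (R (Gs y)) := by
    rw [hR, inner_weightedSampling, inner_weightedSampling]
    exact Finset.sum_congr rfl fun e he => by rw [hΩ e he]
  have hGsy : ‖Gs y‖ ≤ ‖y‖ := norm_adjoint_normHankel_le hd₁ hd₂ y
  have h2 : inner ℝ (Gs y) (R (Gs y)) ≤ ‖R‖ * ‖y‖ ^ 2 :=
    calc _ ≤ ‖Gs y‖ * ‖R (Gs y)‖ := real_inner_le_norm _ _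
      _ ≤ ‖Gs y‖ * (‖R‖ * ‖Gs y‖) := by gcongr; exact R.le_opNorm _
      _ ≤ ‖y‖ * (‖R‖ * ‖y‖) := by gcongr
      _ = _ := by ring
  -- The RIP operator tested against `P H` on both sides.
  have h3 : ‖Gs (P H)‖ ^ 2 - inner ℝ (Gs (P H)) (R (Gs (P H))) ≤ 1 / 5 * ‖P H‖ ^ 2 := by
    have h4 := ContinuousLinearMap.le_of_opNorm_le _ h (P H)
    have h5 := (neg_le_abs _).trans (abs_real_inner_le_norm (P H)
      ((P ∘L G ∘L R ∘L Gs ∘L P - P ∘L G ∘L Gs ∘L P) (P H)))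
    have hsym : ∀ v, inner ℝ (P H) (P v) = inner ℝ (P H) v := by
      intro v
      rw [← Submodule.inner_starProjection_left_eq_right, ← hP, hPx]
    rw [_root_.sub_apply, inner_sub_right] at h5
    simp only [ContinuousLinearMap.comp_apply, hPx, hsym] at h5
    have hadj : ∀ v, inner ℝ (P H) (G v) = inner ℝ (Gs (P H)) v := fun v =>
      (ContinuousLinearMap.adjoint_inner_left G v (P H)).symm
    rw [hadj, hadj, real_inner_self_eq_norm_sq] at h5
    have h6 := mul_le_mul_of_nonneg_left h4 (norm_nonneg (P H))
    simp only [_root_.sub_apply, ContinuousLinearMap.comp_apply, ← hP, ← hG, ← hGs,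
      hPx] at h6
    linarith
  have h7 : ‖P H‖ ≤ ‖H‖ := Submodule.norm_starProjection_apply_le _ _
  have h8 : ‖H‖ ≤ ‖Gs (P H)‖ + ‖y‖ := by
    rw [← hnorm, ← hsum]
    exact (norm_add_le _ _).trans (by gcongr)
  have h9 : ‖Gs (P H)‖ ≤ √‖R‖ * ‖y‖ + ‖H‖ / 2 := by
    -- Here `1 / 5 ≤ (1 / 2)²` is used; the term `‖H‖ / 2` is later absorbed by `‖H‖`, which
    -- produces the factor `2`.
    refine le_of_sq_le_sq ?_ (by positivity)
    have h10 : ‖P H‖ ^ 2 ≤ ‖H‖ ^ 2 := by gcongr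
    have h11 : (√‖R‖ * ‖y‖) ^ 2 = ‖R‖ * ‖y‖ ^ 2 := by
      rw [mul_pow, Real.sq_sqrt (norm_nonneg _)]
    have h12 : 0 ≤ √‖R‖ * ‖y‖ * ‖H‖ := by positivity
    nlinarith
  linarith

/-- `H` differs from the product on the right by an element of the tangent space, and the orthogonal
projection gives the nearest point. The freedom in `B₁`, `B₂` allows a pseudoinverse of a different
matrix to be used. -/
theorem norm_sub_starProjection_tangentSpace_le (Z H : BlockMat n d₁ d₂)
    (B₁ B₂ : Matrix (Fin d₂ × Fin n) (Fin d₁ × Fin n) ℝ) :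
    ‖toFrob n d₁ d₂ H - (tangentSpace Z).starProjection (toFrob n d₁ d₂ H)‖ ≤
      fro ((1 - Z * B₁) * H * (1 - B₂ * Z)) := by
  have hmem : toFrob n d₁ d₂ (H - (1 - Z * B₁) * H * (1 - B₂ * Z)) ∈ tangentSpace Z := by
    refine ⟨B₁ * H, (1 - Z * B₁) * H * B₂, ?_⟩
    congr 1
    simp only [Matrix.sub_mul, Matrix.mul_sub, Matrix.one_mul, Matrix.mul_one, Matrix.mul_assoc]
    abel
  have h := Submodule.starProjection_minimal (U := tangentSpace Z) (toFrob n d₁ d₂ H)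
  rw [h]
  refine (ciInf_le ⟨0, ?_⟩ ⟨_, hmem⟩).trans (le_of_eq ?_)
  · rintro _ ⟨x, rfl⟩
    exact norm_nonneg _
  · rw [← norm_toFrob, ← map_sub, sub_sub_cancel]

end

/-! ### Singular values, rank and pseudoinverses. -/

section

variable {m k : Type*} [Fintype m] [Fintype k] [DecidableEq m] [DecidableEq k]

theorem finrank_range_toEuclideanLin (M : Matrix m k ℝ) :
    Module.finrank ℝ (LinearMap.range (Matrix.toEuclideanLin M)) = M.rank := by
  rw [Matrix.toEuclideanLin_eq_toLin_orthonormal]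
  exact (Matrix.rank_eq_finrank_range_toLin M _ _).symm

theorem sigma_nonneg (M : Matrix m k ℝ) (i : ℕ) : 0 ≤ sigma M i :=
  LinearMap.singularValues_nonneg _ _

theorem antitone_sigma (M : Matrix m k ℝ) : Antitone (sigma M) := fun _ _ h =>
  LinearMap.singularValues_antitone _ (Nat.sub_le_sub_right h 1)

theorem antitone_sigma_succ (M : Matrix m k ℝ) : Antitone fun i => sigma M (i + 1) :=
  fun _ _ h => antitone_sigma M (by omega)

theorem sigma_pos_of_le_rank {M : Matrix m k ℝ} {i : ℕ} (hi : 1 ≤ i) (h : i ≤ M.rank) :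
    0 < sigma M i := by
  rw [sigma, LinearMap.singularValues_pos_iff_lt_finrank_range, finrank_range_toEuclideanLin]
  omega

theorem sigma_eq_zero_of_rank_lt {M : Matrix m k ℝ} {i : ℕ} (h : M.rank < i) : sigma M i = 0 := by
  rw [sigma, LinearMap.singularValues_eq_zero_iff_le_finrank_range, finrank_range_toEuclideanLin]
  omega

theorem specNorm_sub_comm (M N : Matrix m k ℝ) : specNorm (M - N) = specNorm (N - M) := by
  rw [← specNorm_neg, neg_sub]

/-- Weyl's inequality. -/
theorem sigma_succ_le_add (M N : Matrix m k ℝ) {i : ℕ} (hm : i < Fintype.card m)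
    (hk : i < Fintype.card k) : sigma M (i + 1) ≤ sigma N (i + 1) + specNorm (M - N) := by
  obtain ⟨U, V, h⟩ := exists_hasSVD rfl rfl M
  obtain ⟨U', V', h'⟩ := exists_hasSVD rfl rfl N
  exact h.le_add_specNorm_sub h' (antitone_sigma_succ M) (fun _ => sigma_nonneg M _)
    (antitone_sigma_succ N) (fun _ => sigma_nonneg N _) hm hk

/-- A pseudoinverse of a matrix of rank `r`, with its Frobenius norm. -/
theorem exists_pinv (M : Matrix m k ℝ) (hr : 1 ≤ M.rank) :
    ∃ B : Matrix k m ℝ, M * B * M = M ∧ fro B ≤ √(M.rank : ℝ) * (sigma M M.rank)⁻¹ := by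
  obtain ⟨U, V, h⟩ := exists_hasSVD rfl rfl M
  have hpos := sigma_pos_of_le_rank hr le_rfl
  have hle : ∀ i, i < M.rank → sigma M M.rank ≤ sigma M (i + 1) := fun i hi =>
    antitone_sigma M hi
  exact ⟨truncPinv U V _ M.rank,
    h.mul_truncPinv_mul M.rank_le_card_width (fun i hi => (hpos.trans_le (hle i hi)).ne')
      (fun i hi => sigma_eq_zero_of_rank_lt (by omega)), h.fro_truncPinv_le hpos hle⟩

end

/-! ### Rank of the Hankel matrix, optimality conditions, and one step of TOIRLS. -/

section

variable {n d₁ d₂ : ℕ}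

/-- The block Hankel matrix of the powers of `A` has the same rank as `A`. -/
theorem rank_hankel_powers (hd₁ : 0 < d₁) (hd₂ : 0 < d₂) (A : Matrix (Fin n) (Fin n) ℝ) :
    (hankel n d₁ d₂ (powers (d₁ + d₂ - 1) A)).rank = A.rank := by
  apply le_antisymm
  · have h : hankel n d₁ d₂ (powers (d₁ + d₂ - 1) A) =
        (Matrix.of fun (p : Fin d₁ × Fin n) j => (A ^ (p.1 : ℕ)) p.2 j) *
          (A * (Matrix.of fun i (q : Fin d₂ × Fin n) => (A ^ (q.1 : ℕ)) i q.2)) := by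
      ext p q
      have h1 : hankel n d₁ d₂ (powers (d₁ + d₂ - 1) A) p q =
          (A ^ (p.1 : ℕ) * (A * A ^ (q.1 : ℕ))) p.2 q.2 := by
        rw [← pow_succ', ← pow_add]
        rfl
      rw [h1]
      simp [Matrix.mul_apply]
    rw [h]
    exact (Matrix.rank_mul_le_right _ _).trans (Matrix.rank_mul_le_left _ _)
  · have h : A = (hankel n d₁ d₂ (powers (d₁ + d₂ - 1) A)).submatrix
        (fun i => (⟨0, hd₁⟩, i)) (fun j => (⟨0, hd₂⟩, j)) := by
      ext i j
      have h1 : (hankel n d₁ d₂ (powers (d₁ + d₂ - 1) A)).submatrix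
        (fun i => (⟨0, hd₁⟩, i)) (fun j => (⟨0, hd₂⟩, j)) i j = (A ^ (0 + 0 + 1)) i j := rfl
      rw [h1, zero_add, zero_add, pow_one]
    conv_lhs => rw [h]
    exact Matrix.rank_submatrix_le _ _ _

theorem IsSVD.hasSVD {M : BlockMat n d₁ d₂} {U : Matrix (Fin d₁ × Fin n) (Fin (d₁ * n)) ℝ}
    {V : Matrix (Fin d₂ × Fin n) (Fin (d₂ * n)) ℝ} (h : IsSVD M U V) :
    HasSVD M U V fun i => sigma M (i + 1) :=
  ⟨h.left_orth, h.left_orth', h.right_orth, h.right_orth', h.eq⟩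

theorem weightOp_toFrob (M : BlockMat n d₁ d₂) (ε : ℝ)
    (U : Matrix (Fin d₁ × Fin n) (Fin (d₁ * n)) ℝ)
    (V : Matrix (Fin d₂ × Fin n) (Fin (d₂ * n)) ℝ) (Z : BlockMat n d₁ d₂) :
    weightOp M ε U V (toFrob n d₁ d₂ Z) = toFrob n d₁ d₂
      (conjDiag U (fun i => (max (sigma M (i + 1)) ε)⁻¹) * Z *
        conjDiag V (fun i => (max (sigma M (i + 1)) ε)⁻¹)) := rfl

theorem inner_weightOp_comm (M : BlockMat n d₁ d₂) (ε : ℝ)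
    (U : Matrix (Fin d₁ × Fin n) (Fin (d₁ * n)) ℝ)
    (V : Matrix (Fin d₂ × Fin n) (Fin (d₂ * n)) ℝ) (Y Z : BlockMat n d₁ d₂) :
    inner ℝ (toFrob n d₁ d₂ Y) (weightOp M ε U V (toFrob n d₁ d₂ Z)) =
      inner ℝ (toFrob n d₁ d₂ Z) (weightOp M ε U V (toFrob n d₁ d₂ Y)) := by
  rw [weightOp_toFrob, weightOp_toFrob, inner_toFrob, inner_toFrob, ← Matrix.trace_transpose]
  simp only [Matrix.transpose_mul, Matrix.transpose_transpose, conjDiag_transpose]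
  rw [Matrix.mul_assoc, Matrix.trace_mul_comm]
  simp only [Matrix.mul_assoc]

/-- The first order optimality condition of the weighted least squares problem. -/
theorem IsWLSSolution.orthogonality {W : Frob n d₁ d₂ →L[ℝ] Frob n d₁ d₂}
    (hW : ∀ Y Z, inner ℝ (toFrob n d₁ d₂ Y) (W (toFrob n d₁ d₂ Z)) =
      inner ℝ (toFrob n d₁ d₂ Z) (W (toFrob n d₁ d₂ Y)))
    {Ω : Finset (Fin n × Fin n × Fin (d₁ + d₂ - 1))} {y : Ω → ℝ} {X N : Blocks n (d₁ + d₂ - 1)}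
    (h : IsWLSSolution (effective W) Ω y X) (hN : ∀ e ∈ Ω, N e = 0) :
    inner ℝ (hankelF n d₁ d₂ N) (W (hankelF n d₁ d₂ X)) = 0 := by
  have hq : ∀ Y, inner ℝ Y (effective W Y) =
      inner ℝ (hankelF n d₁ d₂ Y) (W (hankelF n d₁ d₂ Y)) := by
    intro Y
    rw [effective, ContinuousLinearMap.comp_apply, ContinuousLinearMap.adjoint_inner_right,
      ContinuousLinearMap.comp_apply]
  have hW' : inner ℝ (hankelF n d₁ d₂ X) (W (hankelF n d₁ d₂ N)) =
      inner ℝ (hankelF n d₁ d₂ N) (W (hankelF n d₁ d₂ X)) := hW _ _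
  -- Moving along `N` keeps the constraint, so this quadratic in `t` with zero constant term is
  -- nonnegative; its discriminant forces the linear coefficient to vanish.
  have key : ∀ t : ℝ, 0 ≤ inner ℝ (hankelF n d₁ d₂ N) (W (hankelF n d₁ d₂ N)) * (t * t) +
      (2 * inner ℝ (hankelF n d₁ d₂ N) (W (hankelF n d₁ d₂ X))) * t + 0 := by
    intro t
    have hs : sample Ω (X + t • N) = y := by
      rw [← h.1]
      ext e
      simp [sample, hN e.1 e.2]
    have h1 := h.2 (X + t • N) hs
    rw [hq, hq, map_add, map_smul, map_add, map_smul, inner_add_left, inner_add_right,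
      inner_add_right, inner_smul_left, inner_smul_left, inner_smul_right, inner_smul_right,
      hW'] at h1
    simp only [conj_trivial] at h1
    linarith
  have := discrim_le_zero key
  rw [discrim] at this
  nlinarith [sq_nonneg (inner ℝ (hankelF n d₁ d₂ N) (W (hankelF n d₁ d₂ X)))]

namespace IsRun

variable {Ω : Finset (Fin n × Fin n × Fin (d₁ + d₂ - 1))} {y : Ω → ℝ} {rt : ℕ}
  {X : ℕ → Blocks n (d₁ + d₂ - 1)} {ε : ℕ → ℝ}

theorem smoothing_nonneg (h : IsRun d₁ d₂ Ω y rt X ε) {j : ℕ} (hj : 1 ≤ j) : 0 ≤ ε j := by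
  induction j, hj using Nat.le_induction with
  | base => rw [h.smooth_first]; exact sigma_nonneg _ _
  | succ j hj ih => rw [h.smooth j hj]; exact le_min ih (sigma_nonneg _ _)

theorem sample_eq (h : IsRun d₁ d₂ Ω y rt X ε) {j : ℕ} (hj : 1 ≤ j) : sample Ω (X j) = y := by
  induction j, hj using Nat.le_induction with
  | base => exact h.first.1
  | succ j hj ih =>
    rcases (h.smoothing_nonneg hj).eq_or_lt with h0 | h0
    · rw [h.halt j hj h0.symm, ih]
    · obtain ⟨U, V, -, hs⟩ := h.step j hj h0
      exact hs.1

end IsRun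

/-- One step of TOIRLS near the ground truth `M = H(X₀)`. The numbers `a`, `b`, `c` stand for the
square roots of `‖R‖`, of the rank and of the corank. -/
theorem IsRun.local_step {Ω : Finset (Fin n × Fin n × Fin (d₁ + d₂ - 1))} {r : ℕ}
    {X : ℕ → Blocks n (d₁ + d₂ - 1)} {ε : ℕ → ℝ} {X₀ : Blocks n (d₁ + d₂ - 1)}
    {M : BlockMat n d₁ d₂} (hM : M = hankel n d₁ d₂ X₀)
    (h : IsRun d₁ d₂ Ω (sample Ω X₀) r X ε)
    (hr1 : 1 ≤ r) (hp : r < d₁ * n) (hq : r < d₂ * n) (hrank : M.rank = r) {a b c : ℝ}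
    (ha : 1 ≤ a) (hb : 1 ≤ b) (hc1 : 1 ≤ c) (hbr : √(r : ℝ) ≤ b)
    (hc : √((min (d₁ * n) (d₂ * n) - r : ℕ) : ℝ) ≤ c)
    (hnsp : ∀ N : Blocks n (d₁ + d₂ - 1), (∀ e ∈ Ω, N e = 0) →
      ∀ B₁ B₂ : Matrix (Fin d₂ × Fin n) (Fin d₁ × Fin n) ℝ,
        fro (hankel n d₁ d₂ N) ≤ 4 * a * fro ((1 - M * B₁) * hankel n d₁ d₂ N * (1 - B₂ * M)))
    {j : ℕ} (hj : 1 ≤ j) (hε : ε j = sigma (hankel n d₁ d₂ (X j)) (r + 1))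
    (hδ : 4000 * (a ^ 3 * b * c * specNorm (hankel n d₁ d₂ (X j) - M)) ≤ sigma M r) :
    specNorm (hankel n d₁ d₂ (X (j + 1)) - M) ≤
      100 * a ^ 2 * b * (sigma M r)⁻¹ * specNorm (hankel n d₁ d₂ (X j) - M) ^ 2 ∧
    specNorm (hankel n d₁ d₂ (X (j + 1)) - M) ≤
      1 / 2 * specNorm (hankel n d₁ d₂ (X j) - M) ∧
    ε (j + 1) = sigma (hankel n d₁ d₂ (X (j + 1))) (r + 1) := by
  set σ := sigma M r with hσdef
  have hσ : 0 < σ := sigma_pos_of_le_rank hr1 hrank.ge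
  set Z := hankel n d₁ d₂ (X j) with hZ
  set δ := specNorm (Z - M) with hδdef
  have hδ0 : 0 ≤ δ := specNorm_nonneg _
  obtain ⟨B, hB, hBf⟩ := exists_pinv M (hrank.symm ▸ hr1)
  rw [hrank] at hBf
  replace hBf : fro B ≤ b * σ⁻¹ := hBf.trans (by gcongr)
  have hcard₁ : Fintype.card (Fin d₁ × Fin n) = d₁ * n := by simp
  have hcard₂ : Fintype.card (Fin d₂ × Fin n) = d₂ * n := by simp
  have hw : σ - δ ≤ sigma Z (r - 1 + 1) := by
    have := sigma_succ_le_add M Z (i := r - 1) (by omega) (by omega)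
    rw [specNorm_sub_comm, Nat.sub_add_cancel hr1] at this
    rw [Nat.sub_add_cancel hr1]
    linarith
  have hw0 : ∀ Y : BlockMat n d₁ d₂, sigma Y (r + 1) ≤ specNorm (Y - M) := by
    intro Y
    have := sigma_succ_le_add Y M (i := r) (by omega) (by omega)
    rwa [sigma_eq_zero_of_rank_lt (M := M) (by omega), zero_add] at this
  have hzero : ∀ i, 1 ≤ i → ∀ e ∈ Ω, (X i - X₀) e = 0 := by
    intro i hi e he
    have := congrFun (h.sample_eq hi) ⟨e, he⟩
    simp only [sample] at this
    simp [this]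
  have hsub : ∀ i, hankel n d₁ d₂ (X i) - M = hankel n d₁ d₂ (X i - X₀) := by
    intro i
    rw [map_sub, hM]
  have hnsp' : ∀ i, 1 ≤ i → ∀ B₁ B₂ : Matrix (Fin d₂ × Fin n) (Fin d₁ × Fin n) ℝ,
      fro (hankel n d₁ d₂ (X i) - M) ≤
        4 * a * fro ((1 - M * B₁) * (hankel n d₁ d₂ (X i) - M) * (1 - B₂ * M)) := by
    intro i hi B₁ B₂
    rw [hsub]
    exact hnsp _ (hzero i hi) B₁ B₂
  have hac : 1 ≤ a ^ 2 * c := one_le_mul_of_one_le_of_one_le (one_le_pow₀ ha) hc1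
  have hδ' : 4000 * (a * b * δ) ≤ σ := by
    have h1 : a * b * δ ≤ a * b * δ * (a ^ 2 * c) :=
      le_mul_of_one_le_right (by positivity) hac
    nlinarith
  -- The run supplies a decomposition only while `ε j > 0`; the bound `hlow` is also needed when it
  -- has stopped.
  obtain ⟨U₁, V₁, hsvd₁⟩ := exists_hasSVD hcard₁ hcard₂ Z
  have hlow : δ ≤ 10 * a * c * sigma Z (r + 1) :=
    specNorm_sub_le_smoothing hsvd₁ (fun _ => sigma_nonneg Z _) (antitone_sigma_succ Z) hp.le hq.le
      ha hb hc hσ hB hBf hw (hw0 Z) (hnsp' j hj) hδ'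
  -- If the smoothing parameter is zero, `hlow` shows that the iterate is already exact, and the
  -- halted run stays there.
  rcases (h.smoothing_nonneg hj).eq_or_lt with he | he
  · have hXj := h.halt j hj he.symm
    have hδz : δ = 0 := by
      rw [← hε, ← he, mul_zero] at hlow
      exact le_antisymm hlow hδ0
    rw [hXj, ← hZ, ← hδdef, hδz]
    refine ⟨by simp, by simp, ?_⟩
    rw [h.smooth j hj, hXj, ← hZ, ← hε, min_self]
  · obtain ⟨U, V, hsvd, hsol⟩ := h.step j hj he
    set H := hankel n d₁ d₂ (X (j + 1)) - M with hH
    have hopt := hsol.orthogonality (inner_weightOp_comm Z (ε j) U V) (hzero (j + 1) (by omega))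
    rw [hankelF_eq, hankelF_eq, ← hsub, ← hH, weightOp_toFrob, inner_toFrob, hε,
      show hankel n d₁ d₂ (X (j + 1)) = M + H by rw [hH]; abel] at hopt
    have hfro := fro_le_of_optimality hsvd.hasSVD (fun _ => sigma_nonneg Z _)
      (antitone_sigma_succ Z) hp.le hq.le ha hb hσ hB hBf hw (hw0 Z) (hnsp' (j + 1) (by omega))
      hδ' (hε ▸ he) hopt
    have hspec := (specNorm_le_fro H).trans hfro
    rw [← hδdef] at hspec
    refine ⟨hspec, hspec.trans ?_, ?_⟩
    · have h1 : 100 * a ^ 2 * b * σ⁻¹ * δ ^ 2 = 100 * (a ^ 2 * b * δ) / σ * δ := by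
        field_simp
      rw [h1]
      refine mul_le_mul_of_nonneg_right ?_ hδ0
      rw [div_le_iff₀ hσ]
      have h2 : a ^ 2 * b * δ ≤ a ^ 2 * b * δ * (a * c) :=
        le_mul_of_one_le_right (by positivity) (one_le_mul_of_one_le_of_one_le ha hc1)
      nlinarith
    -- The minimum is the new singular value: Weyl bounds it by the new error, and one factor `δ` of
    -- the quadratic bound is converted into `ε j` by `hlow`. This is where `a³ b c` arises.
    · rw [h.smooth j hj, min_eq_right]
      refine (hw0 _).trans (hspec.trans ?_)
      have h1 : 100 * a ^ 2 * b * σ⁻¹ * δ ^ 2 = 100 * (a ^ 2 * b * δ) / σ * δ := by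
        field_simp
      rw [h1]
      calc 100 * (a ^ 2 * b * δ) / σ * δ ≤
            100 * (a ^ 2 * b * δ) / σ * (10 * a * c * sigma Z (r + 1)) := by gcongr
        _ = 1000 * (a ^ 3 * b * c * δ) / σ * ε j := by rw [hε]; ring
        _ ≤ 1 * ε j := by
          gcongr
          rw [div_le_one hσ]
          have : 0 ≤ a ^ 3 * b * c * δ := by positivity
          linarith
        _ = ε j := one_mul _

end

/-! ### Assembling the proof. -/

theorem LocalRIP.nullSpaceProperty {n d₁ d₂ : ℕ} (hd₁ : 0 < d₁) (hd₂ : 0 < d₂)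
    {Ω : Finset (Fin n × Fin n × Fin (d₁ + d₂ - 1))}
    {w : Fin n × Fin n × Fin (d₁ + d₂ - 1) → ℝ} {Z : BlockMat n d₁ d₂}
    (h : LocalRIP (weightedSampling Ω w) Z (1 / 5)) (h1 : 1 ≤ ‖weightedSampling Ω w‖)
    (N : Blocks n (d₁ + d₂ - 1)) (hN : ∀ e ∈ Ω, N e = 0)
    (B₁ B₂ : Matrix (Fin d₂ × Fin n) (Fin d₁ × Fin n) ℝ) :
    fro (hankel n d₁ d₂ N) ≤ 4 * √‖weightedSampling Ω w‖ *
      fro ((1 - Z * B₁) * hankel n d₁ d₂ N * (1 - B₂ * Z)) := by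
  have h2 := norm_hankelF_le_of_localRIP hd₁ hd₂ h hN
  have h3 := norm_sub_starProjection_tangentSpace_le Z (hankel n d₁ d₂ N) B₁ B₂
  rw [hankelF_eq, norm_toFrob] at h2
  have h4 : 1 ≤ √‖weightedSampling Ω w‖ := Real.one_le_sqrt.2 h1
  exact h2.trans (mul_le_mul (by linarith) h3 (norm_nonneg _) (by positivity))

/-- If nothing were sampled, the null space property would apply to `X` itself. Its Hankel matrix
lies in its own tangent space, so it would vanish. -/
theorem LocalRIP.nonempty {n d₁ d₂ : ℕ} (hd₁ : 0 < d₁) (hd₂ : 0 < d₂)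
    {Ω : Finset (Fin n × Fin n × Fin (d₁ + d₂ - 1))}
    {w : Fin n × Fin n × Fin (d₁ + d₂ - 1) → ℝ} {X : Blocks n (d₁ + d₂ - 1)}
    (h : LocalRIP (weightedSampling Ω w) (hankel n d₁ d₂ X) (1 / 5))
    (hX : hankel n d₁ d₂ X ≠ 0) : Ω.Nonempty := by
  by_contra hΩ
  rw [Finset.not_nonempty_iff_eq_empty] at hΩ
  have h1 := norm_hankelF_le_of_localRIP hd₁ hd₂ h (X := X) (by simp [hΩ])
  have hmem : hankelF n d₁ d₂ X ∈ tangentSpace (hankel n d₁ d₂ X) :=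
    ⟨1, 0, by rw [Matrix.mul_one, Matrix.zero_mul, add_zero]; rfl⟩
  rw [Submodule.starProjection_eq_self_iff.2 hmem, sub_self, norm_zero, mul_zero,
    norm_le_zero_iff, hankelF_eq] at h1
  exact hX ((toFrob n d₁ d₂).map_eq_zero_iff.1 h1)

theorem tendsto_of_specNorm_sub_le_half {m k : Type*} [Fintype m] [Fintype k] [DecidableEq m]
    [DecidableEq k] {Z : ℕ → Matrix m k ℝ} {M : Matrix m k ℝ}
    (h : ∀ l, specNorm (Z (l + 1) - M) ≤ 1 / 2 * specNorm (Z l - M)) :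
    Filter.Tendsto Z Filter.atTop (nhds M) := by
  have h1 : ∀ l, specNorm (Z l - M) ≤ (1 / 2) ^ l * specNorm (Z 0 - M) := by
    intro l
    induction l with
    | zero => simp
    | succ l ih =>
      refine (h l).trans ?_
      rw [pow_succ]
      linarith
  have h2 : Filter.Tendsto (fun l : ℕ => (1 / 2 : ℝ) ^ l * specNorm (Z 0 - M)) Filter.atTop
      (nhds 0) := by
    have := (tendsto_pow_atTop_nhds_zero_of_lt_one (r := (1 / 2 : ℝ)) (by norm_num)
      (by norm_num)).mul_const (specNorm (Z 0 - M))
    rwa [zero_mul] at this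
  refine tendsto_pi_nhds.2 fun i => tendsto_pi_nhds.2 fun j => ?_
  rw [tendsto_iff_norm_sub_tendsto_zero]
  exact squeeze_zero (fun _ => norm_nonneg _)
    (fun l => (abs_entry_le_specNorm (Z l - M) i j).trans (h1 l)) h2

end TOIRLS

end

theorem proposition7p4 :
    ∃ c₀ : ℝ, 0 < c₀ ∧
      ∀ (n d₁ d₂ r : ℕ) (A : Matrix (Fin n) (Fin n) ℝ)
        (Ω : Finset (Fin n × Fin n × Fin (d₁ + d₂ - 1)))
        (R : TOIRLS.Blocks n (d₁ + d₂ - 1) →L[ℝ] TOIRLS.Blocks n (d₁ + d₂ - 1))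
        (HA : TOIRLS.BlockMat n d₁ d₂) (κ : ℝ),
        1 ≤ r → r < min d₁ d₂ * n → A.rank = r →
        HA = TOIRLS.hankel n d₁ d₂ (TOIRLS.powers (d₁ + d₂ - 1) A) →
        κ = TOIRLS.sigma HA 1 / TOIRLS.sigma HA r →
        TOIRLS.IsNormalizedSampling Ω R →
        TOIRLS.LocalRIP R HA (1 / 5) →
        ∃ ν : ℝ, 0 < ν ∧
          ∀ (X : ℕ → TOIRLS.Blocks n (d₁ + d₂ - 1)) (ε : ℕ → ℝ) (k : ℕ), 1 ≤ k →
            TOIRLS.IsRun d₁ d₂ Ω (TOIRLS.sample Ω (TOIRLS.powers (d₁ + d₂ - 1) A)) r X ε →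
            ε k = TOIRLS.sigma (TOIRLS.hankel n d₁ d₂ (X k)) (r + 1) →
            TOIRLS.specNorm (TOIRLS.hankel n d₁ d₂ (X k) - HA) ≤
              c₀ * ‖R‖ ^ (-(3 / 2) : ℝ) * (r : ℝ)⁻¹ * κ⁻¹ *
                (((min d₁ d₂ * n : ℕ) : ℝ) - (r : ℝ)) ^ (-(1 / 2) : ℝ) * TOIRLS.sigma HA r →
            (∀ l : ℕ,
              TOIRLS.specNorm (TOIRLS.hankel n d₁ d₂ (X (k + l + 1)) - HA) ≤
                min (ν * TOIRLS.specNorm (TOIRLS.hankel n d₁ d₂ (X (k + l)) - HA) ^ 2)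
                  (TOIRLS.specNorm (TOIRLS.hankel n d₁ d₂ (X (k + l)) - HA))) ∧
            Filter.Tendsto (fun l : ℕ => TOIRLS.hankel n d₁ d₂ (X (k + l))) Filter.atTop
              (nhds HA) := by
  -- The reciprocal of the constant required by `IsRun.local_step`.
  refine ⟨1 / 4000, by norm_num, ?_⟩
  intro n d₁ d₂ r A Ω R HA κ hr1 hr hA hHA hκ hR hRIP
  have hpos : 0 < min d₁ d₂ * n := by omega
  have hd : 0 < min d₁ d₂ := Nat.pos_of_mul_pos_right hpos
  have hd₁ : 0 < d₁ := hd.trans_le (min_le_left _ _)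
  have hd₂ : 0 < d₂ := hd.trans_le (min_le_right _ _)
  have hp : r < d₁ * n := hr.trans_le (Nat.mul_le_mul_right n (min_le_left _ _))
  have hq : r < d₂ * n := hr.trans_le (Nat.mul_le_mul_right n (min_le_right _ _))
  have hrank : HA.rank = r := by rw [hHA, TOIRLS.rank_hankel_powers hd₁ hd₂, hA]
  obtain ⟨w, rfl, hw⟩ := TOIRLS.exists_weights hR
  have hΩ : Ω.Nonempty := by
    refine TOIRLS.LocalRIP.nonempty hd₁ hd₂ (hHA ▸ hRIP) fun h0 => ?_
    rw [hHA, h0, Matrix.rank_zero] at hrank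
    omega
  have hρ := TOIRLS.one_le_norm_weightedSampling hw hΩ
  set ρ := ‖TOIRLS.weightedSampling Ω w‖ with hρdef
  set σ := TOIRLS.sigma HA r with hσdef
  have hσ : 0 < σ := TOIRLS.sigma_pos_of_le_rank hr1 hrank.ge
  have hκ1 : 1 ≤ κ := by
    rw [hκ, one_le_div hσ]
    exact TOIRLS.antitone_sigma HA hr1
  have hr1' : (1 : ℝ) ≤ r := by exact_mod_cast hr1
  set D : ℝ := ((min d₁ d₂ * n : ℕ) : ℝ) - (r : ℝ) with hD
  have hD1 : 1 ≤ D := by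
    have : ((r + 1 : ℕ) : ℝ) ≤ ((min d₁ d₂ * n : ℕ) : ℝ) := by exact_mod_cast hr
    push_cast at this
    rw [hD]
    push_cast
    linarith
  have ha : 1 ≤ √ρ := Real.one_le_sqrt.2 hρ
  have hb : 1 ≤ √(r : ℝ) := Real.one_le_sqrt.2 hr1'
  have hc : 1 ≤ √D := Real.one_le_sqrt.2 hD1
  have hcorank : √((min (d₁ * n) (d₂ * n) - r : ℕ) : ℝ) ≤ √D := by
    rw [Nat.mul_min_mul_right, Nat.cast_sub hr.le]
  refine ⟨100 * √ρ ^ 2 * √(r : ℝ) * σ⁻¹, by positivity, ?_⟩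
  intro X ε k hk hrun hεk hδk
  have hinit : 4000 * (√ρ ^ 3 * √(r : ℝ) * √D *
      TOIRLS.specNorm (TOIRLS.hankel n d₁ d₂ (X k) - HA)) ≤ σ := by
    have e1 : ρ ^ (-(3 / 2) : ℝ) = (√ρ ^ 3)⁻¹ := by
      rw [Real.rpow_neg (by positivity), Real.sqrt_eq_rpow, ← Real.rpow_natCast,
        ← Real.rpow_mul (by positivity)]
      norm_num
    have e2 : D ^ (-(1 / 2) : ℝ) = (√D)⁻¹ := by
      rw [Real.rpow_neg (by positivity), Real.sqrt_eq_rpow]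
    rw [e1, e2] at hδk
    -- The step needs the radius only with `√r` and without `κ`; as `r` and `κ` are at least `1`,
    -- the assumed radius is no larger.
    have h1 : (r : ℝ)⁻¹ ≤ (√(r : ℝ))⁻¹ := by
      gcongr
      exact Real.sqrt_le_iff.2 ⟨by positivity, by nlinarith⟩
    have h2 : κ⁻¹ ≤ 1 := inv_le_one_of_one_le₀ hκ1
    have h3 : TOIRLS.specNorm (TOIRLS.hankel n d₁ d₂ (X k) - HA) ≤
        1 / 4000 * (√ρ ^ 3)⁻¹ * (√(r : ℝ))⁻¹ * 1 * (√D)⁻¹ * σ :=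
      hδk.trans (by gcongr)
    calc _ ≤ 4000 * (√ρ ^ 3 * √(r : ℝ) * √D *
          (1 / 4000 * (√ρ ^ 3)⁻¹ * (√(r : ℝ))⁻¹ * 1 * (√D)⁻¹ * σ)) := by gcongr
      _ = σ := by field_simp
  have hstep := fun (j : ℕ) (hj : 1 ≤ j) => TOIRLS.IsRun.local_step hHA hrun hr1 hp hq hrank ha hb
    hc le_rfl hcorank (TOIRLS.LocalRIP.nullSpaceProperty hd₁ hd₂ hRIP hρ) hj
  -- Invariant of the iteration: the smoothing parameter is the current singular value, and the
  -- error stays within the radius because it halves.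
  have hinv : ∀ l, ε (k + l) = TOIRLS.sigma (TOIRLS.hankel n d₁ d₂ (X (k + l))) (r + 1) ∧
      4000 * (√ρ ^ 3 * √(r : ℝ) * √D *
        TOIRLS.specNorm (TOIRLS.hankel n d₁ d₂ (X (k + l)) - HA)) ≤ σ := by
    intro l
    induction l with
    | zero => exact ⟨hεk, hinit⟩
    | succ l ih =>
      obtain ⟨-, h2, h3⟩ := hstep (k + l) (by omega) ih.1 ih.2
      refine ⟨h3, le_trans ?_ ih.2⟩
      have h4 := TOIRLS.specNorm_nonneg (TOIRLS.hankel n d₁ d₂ (X (k + l)) - HA)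
      rw [← add_assoc]
      gcongr
      linarith
  refine ⟨fun l => ?_, ?_⟩
  · obtain ⟨h1, h2, -⟩ := hstep (k + l) (by omega) (hinv l).1 (hinv l).2
    have h4 := TOIRLS.specNorm_nonneg (TOIRLS.hankel n d₁ d₂ (X (k + l)) - HA)
    exact le_min h1 (by linarith)
  · exact TOIRLS.tendsto_of_specNorm_sub_le_half fun l =>
      (hstep (k + l) (by omega) (hinv l).1 (hinv l).2).2.1
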